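/- Let $n, k, \ell$ be integers with $n\ge 3$, $0\le k\le n-2$, $1\le \ell\le \lfloor\tfrac{n-k+1}{3}\rfloor$ and $\tfrac{k(k+1)}{2}+\ell\ge 2$. Then there exists a $C^\infty$ Lorentzian metric $g$ on $\mathbb{R}^n$ (one negative and $n-1$ positive directions at every point) such that (i) there is a $C^\infty$ pseudo-Riemannian metric $\bar g$ on $\mathbb{R}^n$ that is geodesically equivalent to $g$ (every geodesic of $g$ is, after a reparametrization, a geodesic of $\bar g$) but not affinely equivalent to $g$ (the Levi-Civita connections of $g$ and $\bar g$ are different); and (ii) the degree of mobility of $g$ is $D(g)=\tfrac{k(k+1)}{2}+\ell$. Here $D(g)$ is the dimension of the real vector space of all pairs $(a,\lambda)$ of a smooth symmetric $(0,2)$-tensor field $a$ and a smooth $1$-form $\lambda$ on $\mathbb{R}^n$ with $a_{ij,k}=\lambda_i g_{jk}+\lambda_j g_{ik}$, where the comma denotes the covariant derivative with respect to the Levi-Civita connection of $g$. -/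

import Mathlib

open scoped ContDiff

noncomputable section

namespace GeodEquiv

/-- A `(0,2)`-tensor field on `ℝⁿ`, given by its components in the standard coordinates. -/
abbrev TensorField (n : ℕ) : Type := (Fin n → ℝ) → Matrix (Fin n) (Fin n) ℝ

/-- A `1`-form on `ℝⁿ`, given by its components in the standard coordinates. -/
abbrev OneForm (n : ℕ) : Type := (Fin n → ℝ) → Fin n → ℝ

/-- The partial derivative `∂f/∂xₖ` at `x`. -/
def pd {n : ℕ} (k : Fin n) (f : (Fin n → ℝ) → ℝ) (x : Fin n → ℝ) : ℝ :=
  fderiv ℝ f x (Pi.single k 1)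

/-- A smooth pseudo-Riemannian metric (of any signature) on `ℝⁿ`. -/
structure IsPseudoRiemannian {n : ℕ} (g : TensorField n) : Prop where
  smooth : ∀ i j, ContDiff ℝ ∞ fun x => g x i j
  symm : ∀ x, (g x).IsSymm
  nondegenerate : ∀ x, (g x).det ≠ 0

/-- A smooth Lorentzian metric on `ℝⁿ`: at each point one negative and `n - 1` positive
directions. -/
structure IsLorentzian {n : ℕ} (g : TensorField n) : Prop extends IsPseudoRiemannian g where
  sigNeg_eq : ∀ x, sigNeg (g x).toQuadraticForm' = 1
  sigPos_add_one : ∀ x, sigPos (g x).toQuadraticForm' + 1 = n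

/-- The Christoffel symbols `Γ^i_{jk}` of the Levi-Civita connection of `g` at `x`. -/
def christoffel {n : ℕ} (g : TensorField n) (x : Fin n → ℝ) (i j k : Fin n) : ℝ :=
  (1 / 2) * ∑ l, (g x)⁻¹ i l *
    (pd j (fun y => g y l k) x + pd k (fun y => g y l j) x - pd l (fun y => g y j k) x)

/-- The covariant derivative `a_{ij,k}` of a `(0,2)`-tensor field with respect to the Levi-Civita
connection of `g`. -/
def covDeriv {n : ℕ} (g a : TensorField n) (x : Fin n → ℝ) (i j k : Fin n) : ℝ :=
  pd k (fun y => a y i j) x - ∑ l, christoffel g x l k i * a x l j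
    - ∑ l, christoffel g x l k j * a x i l

/-- `γ` restricted to the open interval `I` is an affinely parametrized geodesic of `g`. -/
def IsGeodesicOn {n : ℕ} (g : TensorField n) (γ : ℝ → Fin n → ℝ) (I : Set ℝ) : Prop :=
  ContDiffOn ℝ ∞ γ I ∧ ∀ t ∈ I, ∀ i,
    deriv (deriv γ) t i
      + ∑ j, ∑ k, christoffel g (γ t) i j k * deriv γ t j * deriv γ t k = 0

/-- `γ` restricted to the open interval `I` is a reparametrized geodesic of `g`: it is `c ∘ s`
for a geodesic `c` of `g` on an open interval `J` and a diffeomorphism `s : I → J`. -/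
def IsReparamGeodesicOn {n : ℕ} (g : TensorField n) (γ : ℝ → Fin n → ℝ) (I : Set ℝ) : Prop :=
  ∃ (J : Set ℝ) (s : ℝ → ℝ) (c : ℝ → Fin n → ℝ),
    IsOpen J ∧ J.OrdConnected ∧ Set.BijOn s I J ∧ ContDiffOn ℝ ∞ s I ∧
      (∀ t ∈ I, deriv s t ≠ 0) ∧ IsGeodesicOn g c J ∧ ∀ t ∈ I, γ t = c (s t)

/-- `gbar` is geodesically equivalent to `g`: every geodesic of `g` is a reparametrized geodesic
of `gbar`. -/
def GeodesicallyEquivalent {n : ℕ} (g gbar : TensorField n) : Prop :=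
  ∀ (γ : ℝ → Fin n → ℝ) (I : Set ℝ), IsOpen I → I.OrdConnected →
    IsGeodesicOn g γ I → IsReparamGeodesicOn gbar γ I

/-- The Levi-Civita connections of `g` and `gbar` coincide. -/
def AffinelyEquivalent {n : ℕ} (g gbar : TensorField n) : Prop :=
  ∀ x i j k, christoffel g x i j k = christoffel gbar x i j k

/-- `(a, lam)` is a smooth solution of `a_{ij,k} = λ_i g_{jk} + λ_j g_{ik}`, `a` symmetric. -/
structure IsSinjukovSolution {n : ℕ} (g a : TensorField n) (lam : OneForm n) : Prop where
  smooth_a : ∀ i j, ContDiff ℝ ∞ fun x => a x i j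
  smooth_lam : ∀ i, ContDiff ℝ ∞ fun x => lam x i
  symm : ∀ x, (a x).IsSymm
  eqn : ∀ x i j k, covDeriv g a x i j k = lam x i * g x j k + lam x j * g x i k

theorem pd_add {n : ℕ} (k : Fin n) {f h : (Fin n → ℝ) → ℝ} (hf : ContDiff ℝ ∞ f)
    (hh : ContDiff ℝ ∞ h) (x : Fin n → ℝ) :
    pd k (fun y => f y + h y) x = pd k f x + pd k h x := by
  have h1 := (hf.differentiable (by simp)) x
  have h2 := (hh.differentiable (by simp)) x
  simp only [pd]
  rw [fderiv_fun_add h1 h2]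
  rfl

theorem pd_mul {n : ℕ} (k : Fin n) (r : ℝ) {f : (Fin n → ℝ) → ℝ} (hf : ContDiff ℝ ∞ f)
    (x : Fin n → ℝ) : pd k (fun y => r * f y) x = r * pd k f x := by
  have h1 := (hf.differentiable (by simp)) x
  simp only [pd]
  rw [fderiv_const_mul h1]
  rfl

/-- The real vector space of solutions `(a, lam)` of the Sinjukov equation of `g`. -/
def sinjukovSpace {n : ℕ} (g : TensorField n) : Submodule ℝ (TensorField n × OneForm n) where
  carrier := {p | IsSinjukovSolution g p.1 p.2}
  zero_mem' :=
    { smooth_a := fun _ _ => contDiff_const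
      smooth_lam := fun _ => contDiff_const
      symm := fun _ => Matrix.isSymm_zero
      eqn := by intro x i j k; simp [covDeriv, pd] }
  add_mem' := by
    rintro ⟨a, l⟩ ⟨b, m⟩ ha hb
    refine ⟨fun i j => (ha.smooth_a i j).add (hb.smooth_a i j),
      fun i => (ha.smooth_lam i).add (hb.smooth_lam i),
      fun x => (ha.symm x).add (hb.symm x), fun x i j k => ?_⟩
    have h1 := ha.eqn x i j k
    have h2 := hb.eqn x i j k
    have h3 := pd_add k (ha.smooth_a i j) (hb.smooth_a i j) x
    simp only [covDeriv, Prod.fst_add, Prod.snd_add, Pi.add_apply, Matrix.add_apply, mul_add,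
      Finset.sum_add_distrib] at h1 h2 h3 ⊢
    rw [h3]
    linear_combination h1 + h2
  smul_mem' := by
    rintro r ⟨a, l⟩ ha
    refine ⟨fun i j => contDiff_const.mul (ha.smooth_a i j),
      fun i => contDiff_const.mul (ha.smooth_lam i),
      fun x => (ha.symm x).smul r, fun x i j k => ?_⟩
    have h1 := ha.eqn x i j k
    have h3 := pd_mul k r (ha.smooth_a i j) x
    simp only [covDeriv, Prod.smul_fst, Prod.smul_snd, Pi.smul_apply, Matrix.smul_apply,
      smul_eq_mul, mul_left_comm _ r, ← Finset.mul_sum] at h1 h3 ⊢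
    rw [h3]
    linear_combination r * h1

/-- The degree of mobility `D(g)`: the dimension of the solution space of the Sinjukov equation
(a finite number for every metric in dimension at least two). -/
def degreeOfMobility {n : ℕ} (g : TensorField n) : ℕ :=
  Module.finrank ℝ (sinjukovSpace g)

end GeodEquiv

end

namespace GeodEquiv

/-! ### Calculus of partial derivatives. -/

section Calculus

variable {n : ℕ}

/-! The metric is a product of a flat space of dimension `f` with cones dr² + r²h over flat bases h
of dimension at least two. Writing r = e^s turns each cone into e^{2s}(ds² + h), which is defined on
a full coordinate space, so everything is global on ℝⁿ. One base direction of the last cone is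
timelike.

Geodesic equivalence: the Euler field E of the product is homothetic. Its dual form θ satisfies ∇θ =
g (`pd_θ`), and N = 1 + θ(E) satisfies dN = 2θ and is positive. Hence ḡ = g/N − θ⊗θ/N² has a
Levi-Civita connection that differs from that of g by −(δ^i_j θ_k + δ^i_k θ_j)/N
(`christoffel_projective`). Such a pure-trace change only reparametrizes geodesics, and it is
nonzero because θ is.

Mobility: since ∇θ = g, the symmetric products of the 1-forms θ, dx_1, …, dx_f (flat coordinates)
solve the Sinjukov equation. So do the parallel metrics of the individual cones. This gives
(f+1)(f+2)/2 plus the number of cones. There are no other solutions (`solMap_surjective`). The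
equation prescribes the derivatives of a, and equality of mixed partials then forces enough
components of a and λ to vanish, because a cone over a flat base of dimension at least two is not
flat. The remaining components solve elementary first-order equations and are determined by their
values at the origin.

For k ≥ 1 one takes f = k − 1. For k = 0 one takes f = 0 and one cone fewer, since θ⊗θ then supplies
the missing solution. -/

theorem contDiff_pd {f : (Fin n → ℝ) → ℝ} (hf : ContDiff ℝ ∞ f) (k : Fin n) :
    ContDiff ℝ ∞ fun x => pd k f x :=
  (hf.fderiv_right (m := ∞) (by simp)).clm_apply contDiff_const

theorem pd_comm {f : (Fin n → ℝ) → ℝ} (hf : ContDiff ℝ ∞ f) (i j : Fin n) (x : Fin n → ℝ) :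
    pd i (fun y => pd j f y) x = pd j (fun y => pd i f y) x := by
  have hd : Differentiable ℝ (fderiv ℝ f) :=
    (hf.fderiv_right (m := ∞) (by simp)).differentiable (by simp)
  have h : IsSymmSndFDerivAt ℝ f x := hf.contDiffAt.isSymmSndFDerivAt (by
    rw [minSmoothness_of_isRCLikeNormedField]; exact WithTop.coe_le_coe.mpr (le_top (a := (2 : ℕ∞))))
  have key : ∀ i j : Fin n, pd i (fun y => pd j f y) x
      = fderiv ℝ (fderiv ℝ f) x (Pi.single i 1) (Pi.single j 1) := by
    intro i j
    unfold pd
    rw [fderiv_clm_apply (hd x) (differentiableAt_const _)]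
    simp
  rw [key, key]
  exact h _ _

theorem pd_fmul (k : Fin n) {f h : (Fin n → ℝ) → ℝ} (hf : ContDiff ℝ ∞ f)
    (hh : ContDiff ℝ ∞ h) (x : Fin n → ℝ) :
    pd k (fun y => f y * h y) x = f x * pd k h x + h x * pd k f x := by
  have h1 := (hf.differentiable (by simp)) x
  have h2 := (hh.differentiable (by simp)) x
  simp only [pd]
  rw [fderiv_fun_mul h1 h2]
  simp

theorem pd_const (k : Fin n) (c : ℝ) (x : Fin n → ℝ) : pd k (fun _ => c) x = 0 := by
  simp [pd]

theorem pd_neg (k : Fin n) (f : (Fin n → ℝ) → ℝ) (x : Fin n → ℝ) :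
    pd k (fun y => - f y) x = - pd k f x := by
  simp [pd]

theorem pd_sub (k : Fin n) {f h : (Fin n → ℝ) → ℝ} (hf : ContDiff ℝ ∞ f)
    (hh : ContDiff ℝ ∞ h) (x : Fin n → ℝ) :
    pd k (fun y => f y - h y) x = pd k f x - pd k h x := by
  simp only [sub_eq_add_neg]
  rw [pd_add k hf hh.neg, pd_neg]

theorem pd_inv (k : Fin n) {f : (Fin n → ℝ) → ℝ} (hf : ContDiff ℝ ∞ f) {x : Fin n → ℝ}
    (hx : f x ≠ 0) : pd k (fun y => (f y)⁻¹) x = - pd k f x / f x ^ 2 := by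
  have h1 := ((hf.differentiable (by simp)) x).hasFDerivAt
  have h2 := (hasDerivAt_inv hx).comp_hasFDerivAt x h1
  have h3 : fderiv ℝ (fun y => (f y)⁻¹) x = _ := h2.fderiv
  simp only [pd]
  rw [h3]
  simp
  ring

theorem pd_coord (k i : Fin n) (x : Fin n → ℝ) :
    pd k (fun y => y i) x = if i = k then 1 else 0 := by
  have h : HasFDerivAt (fun y : Fin n → ℝ => y i)
      (ContinuousLinearMap.proj (R := ℝ) (φ := fun _ : Fin n => ℝ) i) x :=
    (ContinuousLinearMap.proj (R := ℝ) (φ := fun _ : Fin n => ℝ) i).hasFDerivAt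
  simp only [pd]
  rw [h.fderiv]
  simp [Pi.single_apply]

theorem pd_exp (k i : Fin n) (x : Fin n → ℝ) :
    pd k (fun y => Real.exp (2 * y i)) x = if i = k then 2 * Real.exp (2 * x i) else 0 := by
  have h0 : HasFDerivAt (fun y : Fin n → ℝ => y i)
      (ContinuousLinearMap.proj (R := ℝ) (φ := fun _ : Fin n => ℝ) i) x :=
    (ContinuousLinearMap.proj (R := ℝ) (φ := fun _ : Fin n => ℝ) i).hasFDerivAt
  have h := (h0.const_mul 2).exp
  simp only [pd]
  rw [h.fderiv]
  by_cases hik : i = k <;> simp [hik, mul_comm]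

theorem eq_of_pd_eq_zero {f : (Fin n → ℝ) → ℝ} (hf : ContDiff ℝ ∞ f)
    (h : ∀ k x, pd k f x = 0) (x y : Fin n → ℝ) : f x = f y := by
  refine is_const_of_fderiv_eq_zero (hf.differentiable (by simp)) (fun z => ?_) x y
  apply ContinuousLinearMap.coe_injective
  refine LinearMap.pi_ext' fun i => LinearMap.ext_ring ?_
  exact h i z

end Calculus

/-! ### Levi-Civita connections and projective change. -/

section Connection

variable {n : ℕ}

/-- A symmetric connection compatible with a nondegenerate metric is its Levi-Civita connection. -/
theorem christoffel_eq {g : TensorField n} (hs : ∀ x, (g x).IsSymm) {x : Fin n → ℝ}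
    (hd : (g x).det ≠ 0) {Γ : Fin n → Fin n → Fin n → ℝ} (hΓ : ∀ i j k, Γ i j k = Γ i k j)
    (h : ∀ i j k, pd k (fun y => g y i j) x
      = ∑ l, Γ l k i * g x l j + ∑ l, Γ l k j * g x i l) (i j k : Fin n) :
    christoffel g x i j k = Γ i j k := by
  have hsx : ∀ a b, g x a b = g x b a := fun a b => (hs x).apply b a
  have hl : ∀ l, pd j (fun y => g y l k) x + pd k (fun y => g y l j) x
      - pd l (fun y => g y j k) x = 2 * ∑ m, g x l m * Γ m j k := by
    intro l
    rw [h, h, h]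
    have e1 : ∑ m, g x l m * Γ m j k = ∑ m, Γ m j k * g x l m :=
      Finset.sum_congr rfl fun m _ => mul_comm _ _
    have e2 : ∑ m, Γ m j l * g x m k = ∑ m, Γ m l j * g x m k :=
      Finset.sum_congr rfl fun m _ => by rw [hΓ]
    have e3 : ∑ m, Γ m k l * g x m j = ∑ m, Γ m l k * g x j m :=
      Finset.sum_congr rfl fun m _ => by rw [hΓ, hsx]
    have e4 : ∑ m, Γ m k j * g x l m = ∑ m, Γ m j k * g x l m :=
      Finset.sum_congr rfl fun m _ => by rw [hΓ]
    rw [e1, e2, e3, e4]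
    ring
  unfold christoffel
  simp only [hl]
  have hinv : (g x)⁻¹ * g x = 1 := Matrix.nonsing_inv_mul _ (isUnit_iff_ne_zero.mpr hd)
  have : ∀ v : Fin n → ℝ, ∑ l, (g x)⁻¹ i l * ∑ m, g x l m * v m = v i := by
    intro v
    have := congrFun (congrArg (fun M => M.mulVec v) hinv) i
    simp only [Matrix.one_mulVec, ← Matrix.mulVec_mulVec] at this
    exact this
  have h2 := this (fun m => Γ m j k)
  rw [← h2, Finset.mul_sum]
  exact Finset.sum_congr rfl fun l _ => by ring

/-- If `θ` satisfies `∇θ = g` and `dN = 2θ`, then `g / N - θ ⊗ θ / N²` has the geodesics of `g`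
up to reparametrization. -/
theorem christoffel_projective {g : TensorField n} {θ : OneForm n} {N : (Fin n → ℝ) → ℝ}
    {Γ : (Fin n → ℝ) → Fin n → Fin n → Fin n → ℝ} (hΓ : ∀ x i j k, Γ x i j k = Γ x i k j)
    (hg : ∀ i j, ContDiff ℝ ∞ fun x => g x i j) (hs : ∀ x, (g x).IsSymm)
    (hθ : ∀ i, ContDiff ℝ ∞ fun x => θ x i) (hN : ContDiff ℝ ∞ N) (hN0 : ∀ x, N x ≠ 0)
    (hpg : ∀ x i j k, pd k (fun y => g y i j) x
      = ∑ l, Γ x l k i * g x l j + ∑ l, Γ x l k j * g x i l)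
    (hpθ : ∀ x i k, pd k (fun y => θ y i) x = ∑ l, Γ x l k i * θ x l + g x i k)
    (hpN : ∀ x k, pd k N x = 2 * θ x k) {gbar : TensorField n}
    (hgbar : ∀ x i j, gbar x i j = (N x)⁻¹ * g x i j - (N x)⁻¹ * (N x)⁻¹ * (θ x i * θ x j))
    (hdet : ∀ x, (gbar x).det ≠ 0) (x : Fin n → ℝ) (i j k : Fin n) :
    christoffel gbar x i j k = Γ x i j k
      - (if i = j then θ x k / N x else 0) - (if i = k then θ x j / N x else 0) := by
  have hsx : ∀ x a b, g x a b = g x b a := fun x a b => (hs x).apply b a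
  have hNi : ContDiff ℝ ∞ fun x => (N x)⁻¹ := hN.inv hN0
  refine christoffel_eq (Γ := fun i j k => Γ x i j k
      - (if i = j then θ x k / N x else 0) - (if i = k then θ x j / N x else 0))
    (fun y => ?_) (hdet x) (fun i j k => ?_) (fun i j k => ?_) i j k
  · ext a b
    rw [Matrix.transpose_apply, hgbar, hgbar, hsx]
    ring
  · simp only [hΓ x i j k]; ring
  · simp only [hgbar]
    rw [pd_sub k (hNi.mul (hg i j)) ((hNi.mul hNi).mul ((hθ i).mul (hθ j))),
      pd_fmul k hNi (hg i j), pd_fmul k (hNi.mul hNi) ((hθ i).mul (hθ j)), pd_fmul k hNi hNi,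
      pd_fmul k (hθ i) (hθ j), pd_inv k hN (hN0 x), hpN, hpg, hpθ, hpθ]
    simp only [sub_mul, mul_sub, ite_mul, zero_mul, Finset.sum_sub_distrib, Finset.sum_ite_eq',
      Finset.mem_univ, if_true]
    have e1 : ∑ l, Γ x l k i * ((N x)⁻¹ * g x l j) = (N x)⁻¹ * ∑ l, Γ x l k i * g x l j := by
      rw [Finset.mul_sum]; exact Finset.sum_congr rfl fun _ _ => by ring
    have e2 : ∑ l, Γ x l k j * ((N x)⁻¹ * g x i l) = (N x)⁻¹ * ∑ l, Γ x l k j * g x i l := by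
      rw [Finset.mul_sum]; exact Finset.sum_congr rfl fun _ _ => by ring
    have e3 : ∑ l, Γ x l k i * ((N x)⁻¹ * (N x)⁻¹ * (θ x l * θ x j))
        = (N x)⁻¹ * (N x)⁻¹ * θ x j * ∑ l, Γ x l k i * θ x l := by
      rw [Finset.mul_sum]; exact Finset.sum_congr rfl fun _ _ => by ring
    have e4 : ∑ l, Γ x l k j * ((N x)⁻¹ * (N x)⁻¹ * (θ x i * θ x l))
        = (N x)⁻¹ * (N x)⁻¹ * θ x i * ∑ l, Γ x l k j * θ x l := by
      rw [Finset.mul_sum]; exact Finset.sum_congr rfl fun _ _ => by ring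
    rw [e1, e2, e3, e4, hsx x j k]
    have := hN0 x
    field_simp
    ring

end Connection

/-! ### Reparametrization of geodesics. -/

section Reparametrization

/-- A function with positive smooth derivative on an open interval is a diffeomorphism onto an open
interval. -/
theorem exists_smooth_inverse {s u : ℝ → ℝ} {I : Set ℝ} (hI : IsOpen I) (hIc : I.OrdConnected)
    (hu : ContDiffOn ℝ ∞ u I) (hpos : ∀ t ∈ I, 0 < u t)
    (hs : ∀ t ∈ I, HasDerivAt s (u t) t) :
    ∃ (J : Set ℝ) (τ : ℝ → ℝ), IsOpen J ∧ J.OrdConnected ∧ Set.BijOn s I J ∧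
      ContDiffOn ℝ ∞ s I ∧ ContDiffOn ℝ ∞ τ J ∧ (∀ r ∈ J, τ r ∈ I) ∧
      (∀ t ∈ I, τ (s t) = t) ∧ ∀ r ∈ J, HasDerivAt τ (u (τ r))⁻¹ r := by
  have hsm : ContDiffOn ℝ ∞ s I := by
    rw [contDiffOn_infty_iff_deriv_of_isOpen hI]
    refine ⟨fun t ht => (hs t ht).differentiableAt.differentiableWithinAt, ?_⟩
    exact hu.congr fun t ht => (hs t ht).deriv
  have hcont : ContinuousOn s I := hsm.continuousOn
  have hinj : Set.InjOn s I := by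
    refine (strictMonoOn_of_deriv_pos hIc.convex hcont fun t ht => ?_).injOn
    rw [hI.interior_eq] at ht
    rw [(hs t ht).deriv]
    exact hpos t ht
  -- By the inverse function theorem for strict derivatives, `s` maps the neighbourhood filter of
  -- `t` onto that of `s t`.
  have hopen : IsOpenMap (I.domRestrict s) := by
    rw [isOpenMap_iff_nhds_le]
    intro t
    have hst : HasStrictDerivAt s (u t) t :=
      (hsm.contDiffAt (hI.mem_nhds t.2)).hasStrictDerivAt' (hs t t.2) (by simp)
    have h1 := hst.map_nhds_eq (hpos t t.2).ne'
    have h2 : Filter.map (I.domRestrict s) (nhds t) = Filter.map s (nhds (t : ℝ)) := by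
      rw [← hI.isOpenEmbedding_subtypeVal.map_nhds_eq t]
      rfl
    rw [h2, h1]
    exact le_rfl
  let e : OpenPartialHomeomorph ℝ ℝ :=
    OpenPartialHomeomorph.ofContinuousOpenRestrict (hinj.toPartialEquiv s I) hcont hopen hI
  have he : ∀ r ∈ e.target, ContDiffAt ℝ ∞ e.symm r ∧ HasDerivAt e.symm (u (e.symm r))⁻¹ r := by
    intro r hr
    have hm : e.symm r ∈ I := e.map_target hr
    exact ⟨e.contDiffAt_symm_deriv (hpos _ hm).ne' hr (hs _ hm)
      (hsm.contDiffAt (hI.mem_nhds hm)),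
      e.hasDerivAt_symm hr (hpos _ hm).ne' (hs _ hm)⟩
  refine ⟨e.target, e.symm, e.open_target, ?_, e.bijOn, hsm,
    fun r hr => (he r hr).1.contDiffWithinAt, fun r hr => e.map_target hr,
    fun t ht => e.left_inv ht, fun r hr => (he r hr).2⟩
  have : e.target = s '' I := rfl
  rw [this]
  exact (hIc.isPreconnected.image s hcont).ordConnected

/-- Along a geodesic γ of `g` the change of connection contributes −2θ(γ')/N · γ' = −(log N)' γ'.
The new parameter with ds/dt = 1/N absorbs exactly this term. -/
theorem geodesicallyEquivalent_of_christoffel {n : ℕ} {g gbar : TensorField n} {θ : OneForm n}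
    {N : (Fin n → ℝ) → ℝ} (hN : ContDiff ℝ ∞ N) (hN0 : ∀ x, 0 < N x)
    (hpN : ∀ x k, pd k N x = 2 * θ x k)
    (h : ∀ x i j k, christoffel gbar x i j k = christoffel g x i j k
      - (if i = j then θ x k / N x else 0) - (if i = k then θ x j / N x else 0)) :
    GeodesicallyEquivalent g gbar := by
  rintro γ I hI hIc ⟨hγ, hgeo⟩
  -- The parameter `s` is an integral from a base point of `I`, so the empty interval is separate.
  rcases I.eq_empty_or_nonempty with rfl | ⟨t₀, ht₀⟩
  · exact ⟨∅, id, γ, isOpen_empty, Set.ordConnected_empty, Set.bijOn_id _, contDiffOn_id,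
      by simp, ⟨hγ, by simp⟩, by simp⟩
  have hU : ContDiffOn ℝ ∞ (fun t => N (γ t)) I := hN.comp_contDiffOn hγ
  have hu : ContDiffOn ℝ ∞ (fun t => (N (γ t))⁻¹) I := hU.inv fun t _ => (hN0 _).ne'
  set s : ℝ → ℝ := fun t => ∫ r in t₀..t, (N (γ r))⁻¹ with hsdef
  have hs : ∀ t ∈ I, HasDerivAt s (N (γ t))⁻¹ t := by
    intro t ht
    refine intervalIntegral.integral_hasDerivAt_right ?_ ?_ ?_
    · exact (hu.continuousOn.mono (hIc.uIcc_subset ht₀ ht)).intervalIntegrable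
    · exact hu.continuousOn.stronglyMeasurableAtFilter hI t ht
    · exact hu.continuousOn.continuousAt (hI.mem_nhds ht)
  obtain ⟨J, τ, hJ, hJc, hbij, hsm, hτ, hτI, hτs, hτd⟩ :=
    exists_smooth_inverse hI hIc hu (fun t _ => inv_pos.mpr (hN0 _)) hs
  simp only [inv_inv] at hτd
  have hγd : ∀ t ∈ I, HasDerivAt γ (deriv γ t) t := fun t ht =>
    ((hγ.contDiffAt (hI.mem_nhds ht)).differentiableAt (by simp)).hasDerivAt
  have hγ' : ContDiffOn ℝ ∞ (deriv γ) I :=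
    ((contDiffOn_infty_iff_deriv_of_isOpen hI).mp hγ).2
  have hγdd : ∀ t ∈ I, HasDerivAt (deriv γ) (deriv (deriv γ) t) t := fun t ht =>
    ((hγ'.contDiffAt (hI.mem_nhds ht)).differentiableAt (by simp)).hasDerivAt
  have hNd : ∀ t ∈ I, HasDerivAt (fun t => N (γ t)) (∑ k, 2 * θ (γ t) k * deriv γ t k) t := by
    intro t ht
    have h1 := ((hN.differentiable (by simp)) (γ t)).hasFDerivAt.comp_hasDerivAt t (hγd t ht)
    have h2 : fderiv ℝ N (γ t) (deriv γ t) = ∑ k, 2 * θ (γ t) k * deriv γ t k := by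
      conv_lhs => rw [pi_eq_sum_univ' (deriv γ t)]
      rw [map_sum]
      refine Finset.sum_congr rfl fun k _ => ?_
      rw [map_smul, ← hpN, pd, smul_eq_mul, mul_comm]
    rw [← h2]
    exact h1
  have hc1 : ∀ r ∈ J, HasDerivAt (fun r => γ (τ r)) (N (γ (τ r)) • deriv γ (τ r)) r :=
    fun r hr => (hγd _ (hτI r hr)).scomp r (hτd r hr)
  have hc2 : ∀ r ∈ J, HasDerivAt (deriv fun r => γ (τ r))
      (N (γ (τ r)) • N (γ (τ r)) • deriv (deriv γ) (τ r) +
        (N (γ (τ r)) * ∑ k, 2 * θ (γ (τ r)) k * deriv γ (τ r) k) • deriv γ (τ r)) r := by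
    intro r hr
    have h1 : HasDerivAt (fun r => N (γ (τ r)))
        (N (γ (τ r)) * ∑ k, 2 * θ (γ (τ r)) k * deriv γ (τ r) k) r := by
      exact (hNd _ (hτI r hr)).scomp r (hτd r hr)
    have h2 : HasDerivAt (fun r => deriv γ (τ r)) (N (γ (τ r)) • deriv (deriv γ) (τ r)) r :=
      (hγdd _ (hτI r hr)).scomp r (hτd r hr)
    refine (h1.smul h2).congr_of_eventuallyEq ?_
    filter_upwards [hJ.mem_nhds hr] with q hq
    exact (hc1 q hq).deriv
  refine ⟨J, s, fun r => γ (τ r), hJ, hJc, hbij, hsm, fun t ht => ?_, ⟨?_, ?_⟩, fun t ht => ?_⟩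
  · rw [(hs t ht).deriv]
    exact (inv_pos.mpr (hN0 _)).ne'
  · exact hγ.comp hτ hτI
  · intro r hr i
    rw [(hc2 r hr).deriv, (hc1 r hr).deriv]
    have hg := hgeo _ (hτI r hr) i
    set t := τ r
    set v := deriv γ t
    have hNt := (hN0 (γ t)).ne'
    simp only [h, Pi.add_apply, Pi.smul_apply, smul_eq_mul, sub_mul, ite_mul, zero_mul,
      Finset.sum_sub_distrib, Finset.sum_ite_eq, Finset.mem_univ, if_true]
    rw [Finset.sum_comm (f := fun j k => if i = j then _ else _)]
    simp only [Finset.sum_ite_eq, Finset.mem_univ, if_true]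
    have e1 : ∑ j, ∑ k, christoffel g (γ t) i j k * (N (γ t) * v j) * (N (γ t) * v k)
        = N (γ t) * N (γ t) * ∑ j, ∑ k, christoffel g (γ t) i j k * v j * v k := by
      simp only [Finset.mul_sum]
      exact Finset.sum_congr rfl fun _ _ => Finset.sum_congr rfl fun _ _ => by ring
    have e2 : ∑ k, θ (γ t) k / N (γ t) * (N (γ t) * v i) * (N (γ t) * v k)
        = N (γ t) * v i * ∑ k, θ (γ t) k * v k := by
      rw [Finset.mul_sum]
      exact Finset.sum_congr rfl fun _ _ => by field_simp
    have e3 : ∑ k, θ (γ t) k / N (γ t) * (N (γ t) * v k) * (N (γ t) * v i)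
        = N (γ t) * v i * ∑ k, θ (γ t) k * v k := by
      rw [Finset.mul_sum]
      exact Finset.sum_congr rfl fun _ _ => by field_simp
    have e4 : ∑ k, 2 * θ (γ t) k * v k = 2 * ∑ k, θ (γ t) k * v k := by
      rw [Finset.mul_sum]
      exact Finset.sum_congr rfl fun _ _ => by ring
    rw [e1, e2, e3, e4]
    linear_combination N (γ t) * N (γ t) * hg
  · simp [hτs t ht]

end Reparametrization

end GeodEquiv
-- Products of a flat space and cones.
noncomputable section
namespace GeodEquiv

/-- Data splitting the coordinates of `ℝⁿ` into flat ones (`lead i = none`) and blocks of at least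
three coordinates, each block being given by its leading coordinate `s`; `ε` is a choice of signs
that is positive on flat and on leading coordinates. -/
structure ConeBlocks (n : ℕ) where
  lead : Fin n → Option (Fin n)
  ε : Fin n → ℝ
  lead_lead : ∀ {i s}, lead i = some s → lead s = some s
  ε_mul_self : ∀ i, ε i * ε i = 1
  ε_flat : ∀ {i}, lead i = none → ε i = 1
  ε_lead : ∀ {s}, lead s = some s → ε s = 1
  exists_ne : ∀ {s}, lead s = some s →
    ∃ p q, p ≠ q ∧ p ≠ s ∧ q ≠ s ∧ lead p = some s ∧ lead q = some s

namespace ConeBlocks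

variable {n : ℕ} (B : ConeBlocks n)

theorem ε_ne (i : Fin n) : B.ε i ≠ 0 := fun h => by
  have := B.ε_mul_self i
  simp [h] at this

/-- The diagonal entries of the product of a flat metric and of the cone metrics
`e^{2s} (ds² + ∑ ε_p dy_p²)` of the blocks. -/
def w (x : Fin n → ℝ) (i : Fin n) : ℝ :=
  B.ε i * (B.lead i).elim 1 fun s => Real.exp (2 * x s)

/-- The product of a flat metric and of the cone metrics of the blocks. -/
def metric : TensorField n := fun x => Matrix.diagonal (B.w x)

/-- The Euler vector field, the homothetic field of the product of cones. -/
def euler (x : Fin n → ℝ) (i : Fin n) : ℝ :=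
  if B.lead i = none then x i else if B.lead i = some i then 1 else 0

/-- The metric dual of the Euler vector field. -/
def θ : OneForm n := fun x i => B.w x i * B.euler x i

/-- One plus the squared length of the Euler vector field. -/
def N (x : Fin n → ℝ) : ℝ := 1 + ∑ i, B.θ x i * B.euler x i

/-- The contraction of the Levi-Civita connection of the metric with a covector `f`. -/
def conn (k i : Fin n) (f : Fin n → ℝ) : ℝ :=
  (if B.lead i = some k then f i else 0) + (if B.lead k = some i then f k else 0)
    - if k = i then (B.lead k).elim 0 fun s => B.ε k * B.ε s * f s else 0

/-- The Christoffel symbols of the metric. -/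
def Γ (l k i : Fin n) : ℝ :=
  (if l = i then (if B.lead i = some k then 1 else 0) else 0)
    + (if l = k then (if B.lead k = some i then 1 else 0) else 0)
    - (if k = i then (if B.lead k = some l then B.ε k * B.ε l else 0) else 0)

variable {B}

theorem w_flat {i : Fin n} (h : B.lead i = none) (x : Fin n → ℝ) : B.w x i = 1 := by
  simp [w, h, B.ε_flat h]

theorem w_some {i s : Fin n} (h : B.lead i = some s) (x : Fin n → ℝ) :
    B.w x i = B.ε i * Real.exp (2 * x s) := by
  simp [w, h]

theorem w_lead {s : Fin n} (h : B.lead s = some s) (x : Fin n → ℝ) :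
    B.w x s = Real.exp (2 * x s) := by
  simp [w, h, B.ε_lead h]

theorem w_ne (x : Fin n → ℝ) (i : Fin n) : B.w x i ≠ 0 := by
  rcases h : B.lead i with _ | s
  · simp [w, h, B.ε_ne]
  · simp [w, h, B.ε_ne]

theorem contDiff_w (i : Fin n) : ContDiff ℝ ∞ fun x => B.w x i := by
  rcases h : B.lead i with _ | s
  · simp only [w, h, Option.elim]; fun_prop
  · simp only [w, h, Option.elim]; fun_prop

theorem pd_w (k i : Fin n) (x : Fin n → ℝ) :
    pd k (fun y => B.w y i) x = if B.lead i = some k then 2 * B.w x i else 0 := by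
  rcases h : B.lead i with _ | s
  · simp [w, h, pd_const]
  · simp only [w, h, Option.elim]
    rw [pd_mul k (B.ε i) (by fun_prop), pd_exp]
    by_cases hs : s = k <;> simp [hs]
    ring

theorem metric_apply (x : Fin n → ℝ) (i j : Fin n) :
    B.metric x i j = if i = j then B.w x i else 0 := by
  simp [metric, Matrix.diagonal_apply]

theorem metric_symm (x : Fin n → ℝ) : (B.metric x).IsSymm := Matrix.isSymm_diagonal _

theorem contDiff_metric (i j : Fin n) : ContDiff ℝ ∞ fun x => B.metric x i j := by
  simp only [metric_apply]
  by_cases h : i = j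
  · simpa [h] using contDiff_w j
  · simpa [h] using contDiff_const

theorem isPseudoRiemannian_metric : IsPseudoRiemannian B.metric where
  smooth := contDiff_metric
  symm := metric_symm
  nondegenerate x := by
    rw [metric, Matrix.det_diagonal]
    exact Finset.prod_ne_zero_iff.mpr fun i _ => w_ne x i

/-- In a block led by s the only nonzero symbols are Γ^i_{si} = Γ^i_{is} = 1 for every member i and
Γ^s_{pp} = −ε_p for p ≠ s. Contractions therefore collapse to the closed form `conn`, which replaces
sums over `Γ` in the later component computations. -/
theorem sum_Γ_mul (k i : Fin n) (f : Fin n → ℝ) : ∑ l, B.Γ l k i * f l = B.conn k i f := by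
  simp only [Γ, conn, sub_mul, add_mul, ite_mul, zero_mul, one_mul, Finset.sum_sub_distrib,
    Finset.sum_add_distrib, Finset.sum_ite_eq', Finset.mem_univ, if_true]
  congr 1
  by_cases h : k = i
  · subst h
    rcases hs : B.lead k with _ | s <;> simp
  · simp [h]

theorem Γ_symm (i j k : Fin n) : B.Γ i j k = B.Γ i k j := by
  unfold Γ
  by_cases h : j = k
  · subst h; ring
  · simp [h, Ne.symm h]; ring

theorem pd_metric (x : Fin n → ℝ) (i j k : Fin n) :
    pd k (fun y => B.metric y i j) x
      = B.conn k i (fun l => B.metric x l j) + B.conn k j (fun l => B.metric x i l) := by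
  simp only [metric_apply, conn]
  by_cases hij : i = j
  · subst hij
    simp only [if_true, pd_w]
    by_cases hki : k = i
    · subst hki
      rcases hs : B.lead k with _ | s
      · simp
      · by_cases hsk : s = k
        · subst hsk
          simp [B.ε_mul_self]; ring
        · simp [hsk, Ne.symm hsk]
    · simp [hki, Ne.symm hki]
      split_ifs <;> ring
  -- Off the diagonal the two connection terms cancel, because w_b = ε_b ε_a w_a when a leads the
  -- block of b.
  · have key : ∀ a b : Fin n, a ≠ b → ((if B.lead b = some a then if b = b then B.w x b else 0 else 0)
        - (B.lead b).elim 0 fun s => B.ε b * B.ε s * if s = a then B.w x s else 0) = 0 := by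
      intro a b hab
      rcases hs : B.lead b with _ | s
      · simp
      · by_cases hsa : s = a
        · subst hsa
          simp [w_some hs, w_lead (B.lead_lead hs), B.ε_lead (B.lead_lead hs)]
        · simp [hsa]
    simp only [hij, if_false, ite_self, pd_const]
    by_cases hki : k = i
    · subst hki
      have := key j k (Ne.symm hij)
      simp [hij] at this ⊢
      linarith
    · by_cases hkj : k = j
      · subst hkj
        have h1 : (fun s => B.ε k * B.ε s * if i = s then B.w x i else 0)
            = fun s => B.ε k * B.ε s * if s = i then B.w x s else 0 := by
          funext s
          by_cases hsi : s = i
          · subst hsi; rfl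
          · simp [hsi, Ne.symm hsi]
        have := key i k hij
        rw [← h1] at this
        simp [hij, hki] at this ⊢
        linarith
      · simp [hki, hkj, Ne.symm hki]

theorem christoffel_metric (x : Fin n → ℝ) (i j k : Fin n) :
    christoffel B.metric x i j k = B.Γ i j k :=
  christoffel_eq metric_symm (isPseudoRiemannian_metric.nondegenerate x) Γ_symm
    (fun i j k => by rw [pd_metric, sum_Γ_mul, sum_Γ_mul]) i j k

theorem covDeriv_metric (a : TensorField n) (x : Fin n → ℝ) (i j k : Fin n) :
    covDeriv B.metric a x i j k = pd k (fun y => a y i j) x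
      - B.conn k i (fun l => a x l j) - B.conn k j (fun l => a x i l) := by
  unfold covDeriv
  simp only [christoffel_metric, sum_Γ_mul]

theorem euler_flat {i : Fin n} (h : B.lead i = none) (x : Fin n → ℝ) : B.euler x i = x i := by
  simp [euler, h]

theorem euler_lead {i : Fin n} (h : B.lead i = some i) (x : Fin n → ℝ) : B.euler x i = 1 := by
  simp [euler, h]

theorem euler_of_ne {i s : Fin n} (h : B.lead i = some s) (his : i ≠ s) (x : Fin n → ℝ) :
    B.euler x i = 0 := by
  simp [euler, h, Ne.symm his]

theorem θ_flat {i : Fin n} (h : B.lead i = none) (x : Fin n → ℝ) : B.θ x i = x i := by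
  simp [θ, euler_flat h, w_flat h]

theorem θ_lead {i : Fin n} (h : B.lead i = some i) (x : Fin n → ℝ) : B.θ x i = B.w x i := by
  simp [θ, euler_lead h]

theorem θ_of_ne {i s : Fin n} (h : B.lead i = some s) (his : i ≠ s) (x : Fin n → ℝ) :
    B.θ x i = 0 := by
  simp [θ, euler_of_ne h his]

theorem lead_ne_some_of_ne {i s : Fin n} (h : B.lead i = some s) (his : i ≠ s) (k : Fin n) :
    B.lead k ≠ some i := fun hk => by
  have := B.lead_lead hk
  rw [h] at this
  exact his (Option.some.inj this).symm

theorem lead_ne_some_of_flat {i : Fin n} (h : B.lead i = none) (k : Fin n) :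
    B.lead k ≠ some i := fun hk => by
  have := B.lead_lead hk
  simp [h] at this

theorem contDiff_euler (i : Fin n) : ContDiff ℝ ∞ fun x => B.euler x i := by
  unfold euler
  split_ifs <;> fun_prop

theorem contDiff_θ (i : Fin n) : ContDiff ℝ ∞ fun x => B.θ x i :=
  (contDiff_w i).mul (contDiff_euler i)

theorem contDiff_N : ContDiff ℝ ∞ B.N :=
  contDiff_const.add (ContDiff.sum fun i _ => (contDiff_θ i).mul (contDiff_euler i))

/-- The trichotomy of coordinates: flat, leading, or another member of a block. -/
theorem cases_index (i : Fin n) : B.lead i = none ∨ B.lead i = some i ∨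
    ∃ s, B.lead i = some s ∧ i ≠ s := by
  rcases h : B.lead i with _ | s
  · simp
  · by_cases hs : i = s
    · subst hs; simp
    · exact Or.inr (Or.inr ⟨s, rfl, hs⟩)

/-- This is ∇θ = g. On a cone, r∂_r = ∂_s is dual to e^{2s} ds = d(r²/2), and on the flat factor θ =
d(|x|²/2). -/
theorem pd_θ (x : Fin n → ℝ) (i k : Fin n) :
    pd k (fun y => B.θ y i) x = B.conn k i (B.θ x) + B.metric x i k := by
  rcases B.cases_index i with h | h | ⟨s, h, his⟩
  · simp only [θ_flat h, pd_coord, conn, h, lead_ne_some_of_flat h, metric_apply, w_flat h]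
    by_cases hk : k = i
    · subst hk; simp [h]
    · simp [hk]
  · simp only [θ_lead h, pd_w, conn, h, metric_apply]
    by_cases hk : k = i
    · subst hk; simp [h, θ_lead h, B.ε_mul_self]; ring
    · by_cases hki : B.lead k = some i
      · simp [hk, Ne.symm hk, θ_of_ne hki hk]
      · simp [hk, Ne.symm hk, hki]
  · simp only [θ_of_ne h his, pd_const, conn, h, lead_ne_some_of_ne h his, metric_apply]
    by_cases hk : k = i
    · subst hk
      have hs := B.lead_lead h
      simp [h, θ_lead hs, w_lead hs, w_some h, B.ε_lead hs]
    · simp [hk, Ne.symm hk]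

theorem pd_θ_mul_euler (x : Fin n → ℝ) (i k : Fin n) :
    pd k (fun y => B.θ y i * B.euler y i) x = if i = k then 2 * B.θ x k else 0 := by
  rcases B.cases_index i with h | h | ⟨s, h, his⟩
  · simp only [θ_flat h, euler_flat h]
    rw [pd_fmul k (by fun_prop) (by fun_prop), pd_coord]
    by_cases hk : i = k
    · subst hk; simp [θ_flat h]; ring
    · simp [hk]
  · simp only [θ_lead h, euler_lead h, mul_one, pd_w, h]
    by_cases hk : i = k
    · subst hk; simp [θ_lead h]
    · simp [hk]
  · simp only [θ_of_ne h his, zero_mul, pd_const]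
    by_cases hk : i = k
    · subst hk; simp [θ_of_ne h his]
    · simp [hk]

theorem pd_N (x : Fin n → ℝ) (k : Fin n) : pd k B.N x = 2 * B.θ x k := by
  have hs : ∀ i, ContDiff ℝ ∞ fun x => B.θ x i * B.euler x i :=
    fun i => (contDiff_θ i).mul (contDiff_euler i)
  have h1 : pd k B.N x = ∑ i, pd k (fun y => B.θ y i * B.euler y i) x := by
    unfold pd N
    rw [fderiv_const_add, fderiv_fun_sum fun i _ => ((hs i).differentiable (by simp)) x]
    simp
  rw [h1]
  simp [pd_θ_mul_euler]

/-- The Euler field lives on flat and leading coordinates, where the signs are positive, so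
indefiniteness of the metric does no harm. -/
theorem N_pos (x : Fin n → ℝ) : 0 < B.N x := by
  have : 0 ≤ ∑ i, B.θ x i * B.euler x i := by
    refine Finset.sum_nonneg fun i _ => ?_
    rcases B.cases_index i with h | h | ⟨s, h, his⟩
    · rw [θ_flat h, euler_flat h]; exact mul_self_nonneg _
    · rw [θ_lead h, euler_lead h, w_lead h]; positivity
    · rw [euler_of_ne h his, mul_zero]
  unfold N
  linarith

variable (B) in
/-- A metric geodesically equivalent to the product of cones. -/
def projMetric : TensorField n := fun x => Matrix.of fun i j =>
  (B.N x)⁻¹ * B.metric x i j - (B.N x)⁻¹ * (B.N x)⁻¹ * (B.θ x i * B.θ x j)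

theorem projMetric_apply (x : Fin n → ℝ) (i j : Fin n) : B.projMetric x i j =
    (B.N x)⁻¹ * B.metric x i j - (B.N x)⁻¹ * (B.N x)⁻¹ * (B.θ x i * B.θ x j) := rfl

/-- As a rank-one perturbation of g/N, the matrix has the explicit inverse N(g⁻¹ + E⊗E). This uses
θ(E) = N − 1. -/
theorem det_projMetric_ne (x : Fin n → ℝ) : (B.projMetric x).det ≠ 0 := by
  have hN := (B.N_pos x).ne'
  have h : B.projMetric x * Matrix.of (fun j k =>
      B.N x * ((if j = k then (B.w x k)⁻¹ else 0) + B.euler x j * B.euler x k)) = 1 := by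
    ext i k
    have hsum : ∑ j, B.θ x j * B.euler x j = B.N x - 1 := by simp [N]
    have hk : B.θ x k * (B.w x k)⁻¹ = B.euler x k := by
      rw [θ, mul_comm, ← mul_assoc, inv_mul_cancel₀ (w_ne x k), one_mul]
    have hterm : ∀ j, B.projMetric x i j *
        (B.N x * ((if j = k then (B.w x k)⁻¹ else 0) + B.euler x j * B.euler x k))
        = (if i = j then (if j = k then B.w x i * (B.w x k)⁻¹ else 0) else 0)
          + (if i = j then B.w x i * B.euler x j * B.euler x k else 0)
          - (if j = k then (B.N x)⁻¹ * B.θ x i * (B.θ x j * (B.w x k)⁻¹) else 0)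
          - (B.N x)⁻¹ * B.θ x i * B.euler x k * (B.θ x j * B.euler x j) := by
      intro j
      rw [projMetric_apply, metric_apply]
      split_ifs <;> field_simp <;> ring
    rw [Matrix.mul_apply]
    simp only [Matrix.of_apply, hterm, Finset.sum_sub_distrib, Finset.sum_add_distrib,
      ← Finset.mul_sum, hsum, Finset.sum_ite_eq, Finset.sum_ite_eq', Finset.mem_univ, if_true, hk]
    rw [Matrix.one_apply]
    have h2 : B.w x i * B.euler x i = B.θ x i := rfl
    rw [h2]
    have h3 : (if i = k then B.w x i * (B.w x k)⁻¹ else 0) = if i = k then 1 else 0 := by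
      split_ifs with hik
      · subst hik; exact mul_inv_cancel₀ (w_ne x i)
      · rfl
    rw [h3]
    field_simp
    ring
  have := congrArg Matrix.det h
  rw [Matrix.det_mul, Matrix.det_one] at this
  exact left_ne_zero_of_mul_eq_one this

theorem isPseudoRiemannian_projMetric : IsPseudoRiemannian B.projMetric where
  smooth i j := by
    have hNi : ContDiff ℝ ∞ fun x => (B.N x)⁻¹ := contDiff_N.inv fun x => (N_pos x).ne'
    exact (hNi.mul (contDiff_metric i j)).sub
      ((hNi.mul hNi).mul ((contDiff_θ i).mul (contDiff_θ j)))
  symm x := by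
    ext i j
    rw [Matrix.transpose_apply, projMetric_apply, projMetric_apply, (metric_symm x).apply]
    ring
  nondegenerate := det_projMetric_ne

theorem christoffel_projMetric (x : Fin n → ℝ) (i j k : Fin n) :
    christoffel B.projMetric x i j k = christoffel B.metric x i j k
      - (if i = j then B.θ x k / B.N x else 0) - (if i = k then B.θ x j / B.N x else 0) := by
  rw [christoffel_metric]
  exact christoffel_projective (Γ := fun _ => B.Γ) (fun _ => Γ_symm) contDiff_metric metric_symm
    contDiff_θ contDiff_N (fun x => (N_pos x).ne')
    (fun x i j k => by rw [pd_metric, sum_Γ_mul, sum_Γ_mul])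
    (fun x i k => by rw [pd_θ, sum_Γ_mul]) pd_N projMetric_apply det_projMetric_ne x i j k

theorem geodesicallyEquivalent : GeodesicallyEquivalent B.metric B.projMetric :=
  geodesicallyEquivalent_of_christoffel contDiff_N N_pos pd_N christoffel_projMetric

/-- The two Γ^s_{ss} differ by 2θ_s/N, which is positive on a leading coordinate. -/
theorem not_affinelyEquivalent {s : Fin n} (hs : B.lead s = some s) :
    ¬ AffinelyEquivalent B.metric B.projMetric := fun h => by
  have h1 := h 0 s s s
  rw [christoffel_projMetric, θ_lead hs, w_lead hs] at h1
  have h2 : 0 < Real.exp (2 * (0 : Fin n → ℝ) s) / B.N 0 := div_pos (Real.exp_pos _) (N_pos 0)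
  simp only [if_true] at h1
  linarith

theorem toQuadraticForm'_metric (x : Fin n → ℝ) :
    (B.metric x).toQuadraticForm' = QuadraticMap.weightedSumSquares ℝ (B.w x) := by
  ext v
  simp only [Matrix.toQuadraticForm', metric, LinearMap.BilinMap.toQuadraticMap_apply,
    Matrix.toLinearMap₂'_apply', Matrix.mulVec_diagonal, dotProduct,
    QuadraticMap.weightedSumSquares_apply, smul_eq_mul]
  exact Finset.sum_congr rfl fun i _ => by ring

theorem w_pos_of_ε {i : Fin n} (h : B.ε i = 1) (x : Fin n → ℝ) : 0 < B.w x i := by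
  rcases hl : B.lead i with _ | s
  · simp [w_flat hl]
  · simp [w_some hl, h, Real.exp_pos]

theorem w_neg_of_ε {i : Fin n} (h : B.ε i = -1) (x : Fin n → ℝ) : B.w x i < 0 := by
  rcases hl : B.lead i with _ | s
  · have := B.ε_flat hl
    linarith
  · simp [w_some hl, h, Real.exp_pos]

theorem setOf_w_neg {z : Fin n} (hz : B.ε z = -1) (hε : ∀ i, i ≠ z → B.ε i = 1)
    (x : Fin n → ℝ) : {i | B.w x i < 0} = {z} := by
  ext i
  by_cases hi : i = z
  · subst hi; simp [w_neg_of_ε hz]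
  · simp [hi, (w_pos_of_ε (hε i hi) x).le]

theorem setOf_w_pos {z : Fin n} (hz : B.ε z = -1) (hε : ∀ i, i ≠ z → B.ε i = 1)
    (x : Fin n → ℝ) : {i | 0 < B.w x i} = {z}ᶜ := by
  ext i
  by_cases hi : i = z
  · subst hi; simp [(w_neg_of_ε hz x).le]
  · simp [hi, w_pos_of_ε (hε i hi) x]

theorem isLorentzian_metric {z : Fin n} (hz : B.ε z = -1) (hε : ∀ i, i ≠ z → B.ε i = 1) :
    IsLorentzian B.metric where
  toIsPseudoRiemannian := isPseudoRiemannian_metric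
  sigNeg_eq x := by
    rw [toQuadraticForm'_metric, QuadraticForm.sigNeg_weightedSumSquares, setOf_w_neg hz hε,
      Set.ncard_singleton]
  sigPos_add_one x := by
    rw [toQuadraticForm'_metric, QuadraticForm.sigPos_weightedSumSquares, setOf_w_pos hz hε]
    have := Set.ncard_add_ncard_compl {z}
    rw [Set.ncard_singleton, Nat.card_eq_fintype_card, Fintype.card_fin] at this
    omega

end ConeBlocks

end GeodEquiv
end
noncomputable section
namespace GeodEquiv
namespace ConeBlocks

variable {n : ℕ} {B : ConeBlocks n}

/-! ### Evaluation of the connection on components. -/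

section ConnEval

variable {i j k p q s : Fin n} (f : Fin n → ℝ)

theorem conn_symm : B.conn k i f = B.conn i k f := by
  unfold conn
  by_cases h : k = i
  · subst h; ring
  · simp [h, Ne.symm h]; ring

theorem conn_lead (hi : B.lead i = some s) : B.conn s i f = f i := by
  have hs := B.lead_lead hi
  by_cases h : s = i
  · subst h; simp [conn, hs, B.ε_mul_self]
  · simp [conn, hi, hs, h]

theorem conn_lead' (hi : B.lead i = some s) : B.conn i s f = f i := by
  rw [conn_symm, conn_lead f hi]

theorem conn_self (hp : B.lead p = some s) (hps : p ≠ s) : B.conn p p f = - B.ε p * f s := by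
  have hs := B.lead_lead hp
  simp [conn, hp, B.ε_lead hs, Ne.symm hps]

theorem conn_of_ne (hq : B.lead q = some s) (hp : B.lead p = some s) (hps : p ≠ s) (hqs : q ≠ s)
    (hpq : p ≠ q) : B.conn p q f = 0 := by
  simp [conn, hp, hq, Ne.symm hps, Ne.symm hqs, hpq]

/-- In a product, no Christoffel symbol has lower indices in different factors. -/
theorem conn_of_lead_ne (hk : B.lead k = some s) (hj : B.lead j ≠ some s) : B.conn k j f = 0 := by
  have h1 : k ≠ j := fun h => hj (h ▸ hk)
  have h2 : B.lead j ≠ some k := fun h => by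
    have := B.lead_lead h
    rw [hk] at this
    exact hj (h.trans this.symm)
  have h3 : s ≠ j := fun h => hj (h ▸ B.lead_lead hk)
  simp [conn, hk, h1, h2, h3]

theorem conn_of_lead_ne' (hk : B.lead k = some s) (hj : B.lead j ≠ some s) :
    B.conn j k f = 0 := by
  rw [conn_symm, conn_of_lead_ne f hk hj]

theorem conn_flat (hi : B.lead i = none) : B.conn k i f = 0 := by
  have h2 : B.lead k ≠ some i := lead_ne_some_of_flat hi k
  by_cases h : k = i
  · subst h; simp [conn, hi]
  · simp [conn, hi, h2, h]

theorem conn_eq_zero {f : Fin n → ℝ} (hf : ∀ i, B.lead i ≠ none → f i = 0) :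
    B.conn k i f = 0 := by
  have h1 : (if B.lead i = some k then f i else 0) = 0 := by
    split_ifs with h
    · exact hf i (by simp [h])
    · rfl
  have h2 : (if B.lead k = some i then f k else 0) = 0 := by
    split_ifs with h
    · exact hf k (by simp [h])
    · rfl
  have h3 : ((B.lead k).elim 0 fun s => B.ε k * B.ε s * f s) = 0 := by
    rcases h : B.lead k with _ | s
    · rfl
    · simp [hf s (by simp [B.lead_lead h])]
  simp [conn, h1, h2, h3]

theorem conn_add (f h : Fin n → ℝ) :
    B.conn k i (fun l => f l + h l) = B.conn k i f + B.conn k i h := by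
  simp only [← sum_Γ_mul, mul_add, Finset.sum_add_distrib]

theorem conn_mul (c : ℝ) : B.conn k i (fun l => c * f l) = c * B.conn k i f := by
  simp only [← sum_Γ_mul, Finset.mul_sum]
  exact Finset.sum_congr rfl fun _ _ => by ring

/-- Scaling each block by its own constant commutes with the connection; this makes the separate
block metrics parallel. -/
theorem conn_mul_of_lead_eq {C : Fin n → ℝ} (hC : ∀ i s, B.lead i = some s → C i = C s) :
    B.conn k i (fun l => C l * f l) = C i * B.conn k i f := by
  unfold conn
  have h2 : (if B.lead k = some i then C k * f k else 0)
      = C i * if B.lead k = some i then f k else 0 := by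
    split_ifs with h
    · rw [hC k i h]
    · simp
  have h3 : (if k = i then (B.lead k).elim 0 fun s => B.ε k * B.ε s * (C s * f s) else 0)
      = C i * if k = i then (B.lead k).elim 0 fun s => B.ε k * B.ε s * f s else 0 := by
    split_ifs with h
    · subst h
      rcases hs : B.lead k with _ | s
      · simp
      · simp only [Option.elim, hC k s hs]; ring
    · simp
  rw [h2, h3]
  split_ifs <;> ring

end ConnEval

/-! ### The explicit solutions of the Sinjukov equation. -/

section Solutions

variable (B)

/-- Parameters for the solutions of the Sinjukov equation: a symmetric form on the flat coordinates
together with the Euler direction, and a scalar for every block. -/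
abbrev Param : Type :=
  (Sym2 (Option {i // B.lead i = none}) ⊕ {s // B.lead s = some s}) → ℝ

variable {B}

/-- The coefficient of `θ ⊗ θ`. -/
def coeffθ (v : B.Param) : ℝ := v (Sum.inl s(none, none))

/-- The coefficients of the symmetric products of `θ` with the flat coordinate differentials. -/
def coeffMixed (v : B.Param) (i : Fin n) : ℝ :=
  if h : B.lead i = none then v (Sum.inl s(none, some ⟨i, h⟩)) else 0

/-- The coefficients of the symmetric products of flat coordinate differentials. -/
def coeffFlat (v : B.Param) (i j : Fin n) : ℝ :=
  if h : B.lead i = none ∧ B.lead j = none then v (Sum.inl s(some ⟨i, h.1⟩, some ⟨j, h.2⟩)) else 0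

/-- The coefficient of the metric of the block containing the coordinate `i`. -/
def coeffBlock (v : B.Param) (i : Fin n) : ℝ :=
  if h : (B.lead i).isSome then v (Sum.inr ⟨(B.lead i).get h, B.lead_lead (i := i) (by simp)⟩) else 0

/-- The tensor with given parameters. -/
def solTensor (v : B.Param) : TensorField n := fun x => Matrix.of fun i j =>
  coeffθ v * (B.θ x i * B.θ x j) + coeffMixed v i * B.θ x j + coeffMixed v j * B.θ x i
    + coeffFlat v i j + coeffBlock v i * B.metric x i j

/-- The one-form with given parameters. -/
def solForm (v : B.Param) : OneForm n := fun x i => coeffθ v * B.θ x i + coeffMixed v i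

theorem coeffMixed_of_ne {v : B.Param} {i : Fin n} (h : B.lead i ≠ none) : coeffMixed v i = 0 := by
  simp [coeffMixed, h]

theorem coeffFlat_of_ne {v : B.Param} {i : Fin n} (h : B.lead i ≠ none) (j : Fin n) :
    coeffFlat v i j = 0 := by
  simp [coeffFlat, h]

theorem coeffFlat_symm (v : B.Param) (i j : Fin n) : coeffFlat v i j = coeffFlat v j i := by
  unfold coeffFlat
  by_cases h : B.lead i = none ∧ B.lead j = none
  · rw [dif_pos h, dif_pos h.symm, Sym2.eq_swap]
  · rw [dif_neg h, dif_neg fun h' => h h'.symm]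

theorem coeffBlock_some (v : B.Param) {i s : Fin n} (h : B.lead i = some s) :
    coeffBlock v i = v (Sum.inr ⟨s, B.lead_lead h⟩) := by
  simp [coeffBlock, h]

theorem coeffBlock_flat (v : B.Param) {i : Fin n} (h : B.lead i = none) :
    coeffBlock v i = 0 := by
  simp [coeffBlock, h]

theorem solTensor_apply (v : B.Param) (x : Fin n → ℝ) (i j : Fin n) : solTensor v x i j =
    coeffθ v * (B.θ x i * B.θ x j) + coeffMixed v i * B.θ x j + coeffMixed v j * B.θ x i
    + coeffFlat v i j + coeffBlock v i * B.metric x i j := rfl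

theorem contDiff_solTensor (v : B.Param) (i j : Fin n) :
    ContDiff ℝ ∞ fun x => solTensor v x i j := by
  have h1 := B.contDiff_θ i
  have h2 := B.contDiff_θ j
  have h3 := B.contDiff_metric i j
  simp only [solTensor_apply]
  fun_prop

theorem solTensor_symm (v : B.Param) (x : Fin n → ℝ) : (solTensor v x).IsSymm := by
  ext i j
  rw [Matrix.transpose_apply, solTensor_apply, solTensor_apply, coeffFlat_symm, metric_apply,
    metric_apply]
  by_cases h : i = j
  · subst h; ring
  · simp [h, Ne.symm h]; ring

/-- The product rule suffices: θ has covariant derivative g, while the flat differentials and the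
block metrics are parallel. -/
theorem isSinjukovSolution_sol (v : B.Param) :
    IsSinjukovSolution B.metric (solTensor v) (solForm v) where
  smooth_a := contDiff_solTensor v
  smooth_lam i := by
    have h1 := B.contDiff_θ i
    unfold solForm
    fun_prop
  symm := solTensor_symm v
  eqn x i j k := by
    have h1 := B.contDiff_θ i
    have h2 := B.contDiff_θ j
    have h3 := B.contDiff_metric i j
    have hleft : ∀ i j, B.conn k i (fun l => solTensor v x l j)
        = coeffθ v * B.θ x j * B.conn k i (B.θ x) + coeffMixed v j * B.conn k i (B.θ x)
          + coeffBlock v i * B.conn k i fun l => B.metric x l j := by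
      intro i j
      have e : (fun l => solTensor v x l j) = fun l =>
          (((coeffθ v * B.θ x j) * B.θ x l + B.θ x j * coeffMixed v l + coeffMixed v j * B.θ x l)
            + coeffFlat v l j) + coeffBlock v l * B.metric x l j := by
        funext l; rw [solTensor_apply]; ring
      rw [e, conn_add, conn_add, conn_add, conn_add, conn_mul, conn_mul, conn_mul,
        conn_eq_zero fun i hi => coeffMixed_of_ne (v := v) hi,
        conn_eq_zero fun i hi => coeffFlat_of_ne (v := v) hi j,
        conn_mul_of_lead_eq _ fun i s hs => by
          rw [coeffBlock_some v hs, coeffBlock_some v (B.lead_lead hs)]]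
      ring
    have hright : B.conn k j (fun l => solTensor v x i l)
        = coeffθ v * B.θ x i * B.conn k j (B.θ x) + coeffMixed v i * B.conn k j (B.θ x)
          + coeffBlock v i * B.conn k j fun l => B.metric x i l := by
      have e : (fun l => solTensor v x i l) = fun l =>
          (((coeffθ v * B.θ x i) * B.θ x l + B.θ x i * coeffMixed v l + coeffMixed v i * B.θ x l)
            + coeffFlat v l i) + coeffBlock v i * B.metric x i l := by
        funext l; rw [solTensor_apply, coeffFlat_symm]; ring
      rw [e, conn_add, conn_add, conn_add, conn_add, conn_mul, conn_mul, conn_mul,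
        conn_eq_zero fun i hi => coeffMixed_of_ne (v := v) hi,
        conn_eq_zero fun l hl => coeffFlat_of_ne (v := v) hl i, conn_mul]
      ring
    rw [covDeriv_metric, hleft, hright]
    simp only [solTensor_apply]
    rw [pd_add k (by fun_prop) (by fun_prop), pd_add k (by fun_prop) (by fun_prop),
      pd_add k (by fun_prop) (by fun_prop), pd_add k (by fun_prop) (by fun_prop),
      pd_mul k _ (by fun_prop), pd_mul k _ (by fun_prop), pd_mul k _ (by fun_prop),
      pd_mul k _ (by fun_prop), pd_fmul k h1 h2, pd_θ, pd_θ, pd_const, pd_metric]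
    unfold solForm
    ring

variable (B) in
/-- The parametrization of the solution space. -/
def solMap : B.Param →ₗ[ℝ] sinjukovSpace B.metric where
  toFun v := ⟨(solTensor v, solForm v), isSinjukovSolution_sol v⟩
  map_add' v v' := by
    have h1 : coeffθ (v + v') = coeffθ v + coeffθ v' := rfl
    have h2 : ∀ i, coeffMixed (v + v') i = coeffMixed v i + coeffMixed v' i := by
      intro i; unfold coeffMixed; split_ifs <;> simp
    have h3 : ∀ i j, coeffFlat (v + v') i j = coeffFlat v i j + coeffFlat v' i j := by
      intro i j; unfold coeffFlat; split_ifs <;> simp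
    have h4 : ∀ i, coeffBlock (v + v') i = coeffBlock v i + coeffBlock v' i := by
      intro i; unfold coeffBlock; split_ifs <;> simp
    ext x i
    · rename_i j
      simp only [Submodule.coe_add, Prod.fst_add, Pi.add_apply, Matrix.add_apply, solTensor_apply,
        h1, h2, h3, h4]
      ring
    · simp only [Submodule.coe_add, Prod.snd_add, Pi.add_apply, solForm, h1, h2]
      ring
  map_smul' r v := by
    have h1 : coeffθ (r • v) = r * coeffθ v := rfl
    have h2 : ∀ i, coeffMixed (r • v) i = r * coeffMixed v i := by
      intro i; unfold coeffMixed; split_ifs <;> simp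
    have h3 : ∀ i j, coeffFlat (r • v) i j = r * coeffFlat v i j := by
      intro i j; unfold coeffFlat; split_ifs <;> simp
    have h4 : ∀ i, coeffBlock (r • v) i = r * coeffBlock v i := by
      intro i; unfold coeffBlock; split_ifs <;> simp
    ext x i
    · rename_i j
      simp only [Submodule.coe_smul, Prod.smul_fst, Pi.smul_apply, Matrix.smul_apply,
        solTensor_apply, h1, h2, h3, h4, RingHom.id_apply, smul_eq_mul]
      ring
    · simp only [Submodule.coe_smul, Prod.smul_snd, Pi.smul_apply, solForm, h1, h2,
        RingHom.id_apply, smul_eq_mul]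
      ring

/-- Evaluation at the origin is enough. There θ is supported on leading coordinates, so the `s₀`
component of the 1-form isolates the coefficient of θ⊗θ. The other coefficients can then be read off
one at a time. -/
theorem solMap_injective {s₀ : Fin n} (hs₀ : B.lead s₀ = some s₀) :
    Function.Injective B.solMap := by
  rw [injective_iff_map_eq_zero]
  intro v hv
  have ha : solTensor v = 0 := congrArg (fun z => z.1.1) hv
  have hl : solForm v = 0 := congrArg (fun z => z.1.2) hv
  have hlam : ∀ i, coeffθ v * B.θ 0 i + coeffMixed v i = 0 := fun i => congrFun (congrFun hl 0) i
  have hten : ∀ i j, solTensor v 0 i j = 0 := fun i j => by rw [ha]; rfl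
  have h1 : coeffθ v = 0 := by
    have := hlam s₀
    rw [coeffMixed_of_ne (by simp [hs₀]), θ_lead hs₀, add_zero] at this
    exact (mul_eq_zero.mp this).resolve_right (w_ne 0 s₀)
  have h2 : ∀ i, coeffMixed v i = 0 := fun i => by simpa [h1] using hlam i
  have h3 : ∀ i j, coeffFlat v i j + coeffBlock v i * B.metric 0 i j = 0 := fun i j => by
    simpa [solTensor_apply, h1, h2] using hten i j
  have h4 : ∀ i, B.lead i = some i → coeffBlock v i = 0 := fun i hi => by
    have := h3 i i
    rw [coeffFlat_of_ne (by simp [hi]), zero_add, metric_apply, if_pos rfl] at this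
    exact (mul_eq_zero.mp this).resolve_right (w_ne 0 i)
  funext z
  rcases z with z | ⟨s, hs⟩
  · induction z using Sym2.ind with
    | _ a b =>
      rcases a with _ | ⟨i, hi⟩ <;> rcases b with _ | ⟨j, hj⟩
      · exact h1
      · simpa [coeffMixed, hj] using h2 j
      · rw [Sym2.eq_swap]; simpa [coeffMixed, hi] using h2 i
      · have := h3 i j
        rw [coeffBlock_flat v hi, zero_mul, add_zero] at this
        simpa [coeffFlat, hi, hj] using this
  · have := h4 s hs
    rwa [coeffBlock_some v hs] at this

end Solutions

end ConeBlocks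
end GeodEquiv
end
-- Classification of the solutions.
noncomputable section
namespace GeodEquiv

theorem exists_eq_const_mul_exp {n : ℕ} {f : (Fin n → ℝ) → ℝ} (hf : ContDiff ℝ ∞ f) {s : Fin n}
    (h : ∀ k x, pd k f x = if k = s then 2 * f x else 0) (x : Fin n → ℝ) :
    f x = f 0 * Real.exp (2 * x s) := by
  have he : ∀ x : Fin n → ℝ, Real.exp (2 * x s) ≠ 0 := fun x => (Real.exp_pos _).ne'
  have hE : ContDiff ℝ ∞ fun x : Fin n → ℝ => Real.exp (2 * x s) := by fun_prop
  have hEi : ContDiff ℝ ∞ fun x : Fin n → ℝ => (Real.exp (2 * x s))⁻¹ := hE.inv he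
  have h1 := eq_of_pd_eq_zero (f := fun x => f x * (Real.exp (2 * x s))⁻¹) (hf.mul hEi)
    (fun k x => by
      rw [pd_fmul k hf hEi, pd_inv k hE (he x), pd_exp, h]
      have := he x
      by_cases hk : k = s
      · subst hk; simp; field_simp; ring
      · simp [hk, Ne.symm hk]) x 0
  have := he x
  simp at h1
  field_simp at h1
  rw [h1, mul_comm]

namespace ConeBlocks

variable {n : ℕ} {B : ConeBlocks n}

/-- A block has a non-leading coordinate different from a given one. -/
theorem exists_other {s : Fin n} (hs : B.lead s = some s) (p : Fin n) :
    ∃ q, q ≠ p ∧ q ≠ s ∧ B.lead q = some s := by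
  obtain ⟨q, r, hqr, hqs, hrs, hq, hr⟩ := B.exists_ne hs
  by_cases e : q = p
  · exact ⟨r, e ▸ hqr.symm, hrs, hr⟩
  · exact ⟨q, e, hqs, hq⟩

section Classification

variable {a : TensorField n} {lam : OneForm n} (h : IsSinjukovSolution B.metric a lam)

include h

theorem sol_pd (i j k : Fin n) (x : Fin n → ℝ) :
    pd k (fun y => a y i j) x = B.conn k i (fun l => a x l j) + B.conn k j (fun l => a x i l)
      + lam x i * B.metric x j k + lam x j * B.metric x i k := by
  have := h.eqn x i j k
  rw [covDeriv_metric] at this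
  linarith

theorem sol_symm (x : Fin n → ℝ) (i j : Fin n) : a x i j = a x j i := (h.symm x).apply j i

section OffBlock

variable {s p q j : Fin n} (hj : B.lead j ≠ some s)
include hj

theorem sol_off_y (hp : B.lead p = some s) (hq : B.lead q = some s) (hps : p ≠ s) (hqs : q ≠ s)
    (hpq : p ≠ q) (x : Fin n → ℝ) : pd q (fun y => a y p j) x = 0 := by
  have hqj : j ≠ q := fun e => hj (e ▸ hq)
  rw [sol_pd h, conn_of_ne _ hp hq hqs hps hpq.symm, conn_of_lead_ne _ hq hj]
  simp [metric_apply, hpq, hqj]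

theorem sol_off_y_self (hp : B.lead p = some s) (hps : p ≠ s) (x : Fin n → ℝ) :
    pd p (fun y => a y p j) x = -B.ε p * a x s j + lam x j * B.w x p := by
  have hpj : j ≠ p := fun e => hj (e ▸ hp)
  rw [sol_pd h, conn_self _ hp hps, conn_of_lead_ne _ hp hj]
  simp [metric_apply, hpj]

theorem sol_off_lead_y (hp : B.lead p = some s) (hps : p ≠ s) (x : Fin n → ℝ) :
    pd p (fun y => a y s j) x = a x p j := by
  have hpj : j ≠ p := fun e => hj (e ▸ hp)
  rw [sol_pd h, conn_lead' _ hp, conn_of_lead_ne _ hp hj]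
  simp [metric_apply, hpj, Ne.symm hps]

theorem sol_off_lead (hs : B.lead s = some s) (x : Fin n → ℝ) :
    pd s (fun y => a y s j) x = a x s j + lam x j * B.w x s := by
  have hsj : j ≠ s := fun e => hj (e ▸ hs)
  rw [sol_pd h, conn_lead _ hs, conn_of_lead_ne _ hs hj]
  simp [metric_apply, hsj]

theorem sol_off_y_lead (hp : B.lead p = some s) (hps : p ≠ s) (x : Fin n → ℝ) :
    pd s (fun y => a y p j) x = a x p j := by
  have hs := B.lead_lead hp
  have hsj : j ≠ s := fun e => hj (e ▸ hs)
  rw [sol_pd h, conn_lead _ hp, conn_of_lead_ne _ hs hj]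
  simp [metric_apply, hsj, hps]

/-- Integrability of `a p j` in the directions `s` and `p`: all terms without a derivative of λ
cancel. -/
theorem sol_off_pd_lead_lam (hs : B.lead s = some s) (x : Fin n → ℝ) :
    pd s (fun y => lam y j) x = 0 := by
  obtain ⟨p, -, -, hps, -, hp, -⟩ := B.exists_ne hs
  have ha := h.smooth_a
  have hl := h.smooth_lam
  have hw := B.contDiff_w
  have hc := pd_comm (h.smooth_a p j) s p x
  simp only [sol_off_y_self h hj hp hps, sol_off_y_lead h hj hp hps] at hc
  rw [pd_add _ (by fun_prop) (by fun_prop), pd_mul _ _ (by fun_prop), pd_fmul _ (hl j) (hw p),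
    pd_w, if_pos hp, sol_off_lead h hj hs] at hc
  have e : B.w x p = B.ε p * B.w x s := by rw [w_some hp, w_lead hs]
  have : B.w x p * pd s (fun y => lam y j) x = 0 := by
    rw [e] at hc ⊢
    linarith
  exact (mul_eq_zero.mp this).resolve_left (w_ne x p)

/-- Integrability of `a s j` in the directions `p` and `s`. -/
theorem sol_off_pd_y_lam (hp : B.lead p = some s) (hps : p ≠ s) (x : Fin n → ℝ) :
    pd p (fun y => lam y j) x = 0 := by
  have hs := B.lead_lead hp
  have hl := h.smooth_lam
  have hw := B.contDiff_w
  have ha := h.smooth_a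
  have hc := pd_comm (h.smooth_a s j) p s x
  simp only [sol_off_lead h hj hs, sol_off_lead_y h hj hp hps] at hc
  rw [pd_add _ (by fun_prop) (by fun_prop), pd_fmul _ (hl j) (hw s), pd_w, hs,
    sol_off_lead_y h hj hp hps, sol_off_y_lead h hj hp hps] at hc
  have : B.w x s * pd p (fun y => lam y j) x = 0 := by
    simpa [Ne.symm hps] using hc
  exact (mul_eq_zero.mp this).resolve_left (w_ne x s)

/-- For a second non-leading coordinate `q`, integrability of `a q j` in `p` and `q` leaves only
−ε_q a_{pj}. Block size at least three is essential here. -/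
theorem sol_off_y_eq_zero (hp : B.lead p = some s) (hps : p ≠ s) (x : Fin n → ℝ) :
    a x p j = 0 := by
  have hs := B.lead_lead hp
  have hl := h.smooth_lam
  have hw := B.contDiff_w
  have ha := h.smooth_a
  obtain ⟨q, hqp, hqs, hq⟩ := exists_other hs p
  have hc := pd_comm (h.smooth_a q j) p q x
  simp only [sol_off_y_self h hj hq hqs, sol_off_y h hj hq hp hqs hps hqp] at hc
  rw [pd_add _ (by fun_prop) (by fun_prop), pd_mul _ _ (by fun_prop), pd_fmul _ (hl j) (hw q),
    pd_w, hq, sol_off_pd_y_lam h hj hp hps, sol_off_lead_y h hj hp hps, pd_const] at hc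
  simpa [Ne.symm hps, B.ε_ne] using hc

/-- Since `a p j` vanishes identically, so does its derivative along `p`, which is ε_p(w_s λ_j −
a_{sj}). -/
theorem sol_off_lead_eq (hs : B.lead s = some s) (x : Fin n → ℝ) :
    a x s j = B.w x s * lam x j := by
  obtain ⟨p, -, -, hps, -, hp, -⟩ := B.exists_ne hs
  have h1 := sol_off_y_self h hj hp hps x
  simp only [sol_off_y_eq_zero h hj hp hps, pd_const] at h1
  rw [w_some hp, ← w_lead hs] at h1
  have : B.ε p * (a x s j - B.w x s * lam x j) = 0 := by linarith
  have := (mul_eq_zero.mp this).resolve_left (B.ε_ne p)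
  linarith

end OffBlock

section InBlock

variable {s p q : Fin n}

theorem sol_in_off {i j k : Fin n} (hi : B.lead i = some s) (hj : B.lead j = some s)
    (hk : B.lead k ≠ some s) (x : Fin n → ℝ) : pd k (fun y => a y i j) x = 0 := by
  have hik : i ≠ k := fun e => hk (e ▸ hi)
  have hjk : j ≠ k := fun e => hk (e ▸ hj)
  rw [sol_pd h, conn_of_lead_ne' _ hi hk, conn_of_lead_ne' _ hj hk]
  simp [metric_apply, hik, hjk]

theorem sol_in_self (hp : B.lead p = some s) (hps : p ≠ s) (x : Fin n → ℝ) :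
    pd p (fun y => a y p p) x = 2 * (-B.ε p * a x s p + lam x p * B.w x p) := by
  rw [sol_pd h, conn_self _ hp hps, conn_self _ hp hps, sol_symm h x p s]
  simp [metric_apply]
  ring

theorem sol_in_diag (hp : B.lead p = some s) (hq : B.lead q = some s) (hps : p ≠ s) (hqs : q ≠ s)
    (hpq : p ≠ q) (x : Fin n → ℝ) : pd q (fun y => a y p p) x = 0 := by
  rw [sol_pd h, conn_of_ne _ hp hq hqs hps hpq.symm, conn_of_ne _ hp hq hqs hps hpq.symm]
  simp [metric_apply, hpq]

theorem sol_in_offdiag (hp : B.lead p = some s) (hq : B.lead q = some s) (hps : p ≠ s)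
    (hqs : q ≠ s) (hpq : p ≠ q) (x : Fin n → ℝ) :
    pd p (fun y => a y p q) x = -B.ε p * a x s q + lam x q * B.w x p := by
  rw [sol_pd h, conn_self _ hp hps, conn_of_ne _ hq hp hps hqs hpq]
  simp [metric_apply, hpq.symm]

theorem sol_in_lead_self (hp : B.lead p = some s) (hps : p ≠ s) (x : Fin n → ℝ) :
    pd p (fun y => a y s p) x = a x p p - B.ε p * a x s s + lam x s * B.w x p := by
  rw [sol_pd h, conn_lead' _ hp, conn_self _ hp hps]
  simp [metric_apply, hps.symm]
  ring

theorem sol_in_lead_y (hp : B.lead p = some s) (hq : B.lead q = some s) (hps : p ≠ s)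
    (hqs : q ≠ s) (hpq : p ≠ q) (x : Fin n → ℝ) :
    pd q (fun y => a y s p) x = a x q p := by
  rw [sol_pd h, conn_lead' _ hq, conn_of_ne _ hp hq hqs hps hpq.symm]
  simp [metric_apply, hpq, hqs.symm]

theorem sol_in_lead_lead (hp : B.lead p = some s) (hps : p ≠ s) (x : Fin n → ℝ) :
    pd p (fun y => a y s s) x = 2 * a x s p := by
  rw [sol_pd h, conn_lead' _ hp, conn_lead' _ hp, sol_symm h x p s]
  simp [metric_apply, hps.symm]
  ring

theorem sol_in_pd_lead (hp : B.lead p = some s) (hq : B.lead q = some s) (hps : p ≠ s)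
    (hqs : q ≠ s) (x : Fin n → ℝ) : pd s (fun y => a y p q) x = 2 * a x p q := by
  rw [sol_pd h, conn_lead _ hp, conn_lead _ hq]
  simp [metric_apply, hps, hqs]
  ring

theorem sol_in_pd_lead_lead_y (hp : B.lead p = some s) (hps : p ≠ s) (x : Fin n → ℝ) :
    pd s (fun y => a y s p) x = 2 * a x s p + lam x p * B.w x s := by
  rw [sol_pd h, conn_lead _ (B.lead_lead hp), conn_lead _ hp]
  simp [metric_apply, hps]
  ring

theorem sol_in_pd_lead_lead (hs : B.lead s = some s) (x : Fin n → ℝ) :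
    pd s (fun y => a y s s) x = 2 * a x s s + 2 * (lam x s * B.w x s) := by
  rw [sol_pd h, conn_lead _ hs, conn_lead _ hs]
  simp [metric_apply]
  ring

/-- This and the next three lemmas extract the derivatives of λ inside a block from mixed partials
of `a s s`, `a s p` (twice) and `a q p`. -/
theorem sol_pd_y_lam_lead (hp : B.lead p = some s) (hps : p ≠ s) (x : Fin n → ℝ) :
    pd p (fun y => lam y s) x = lam x p := by
  have hs := B.lead_lead hp
  have hl := h.smooth_lam
  have hw := B.contDiff_w
  have ha := h.smooth_a
  have hc := pd_comm (h.smooth_a s s) p s x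
  simp only [sol_in_lead_lead h hp hps, sol_in_pd_lead_lead h hs] at hc
  rw [pd_add _ (by fun_prop) (by fun_prop), pd_mul _ _ (by fun_prop), pd_mul _ _ (by fun_prop),
    pd_mul _ _ (by fun_prop), pd_fmul _ (hl s) (hw s), pd_w, hs, sol_in_lead_lead h hp hps,
    sol_in_pd_lead_lead_y h hp hps, if_neg (by simpa using hps.symm)] at hc
  refine mul_left_cancel₀ (w_ne (B := B) x s) ?_
  linarith

theorem sol_pd_ne_lam (hp : B.lead p = some s) (hq : B.lead q = some s) (hps : p ≠ s)
    (hqs : q ≠ s) (hpq : p ≠ q) (x : Fin n → ℝ) : pd q (fun y => lam y p) x = 0 := by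
  have hs := B.lead_lead hp
  have hl := h.smooth_lam
  have hw := B.contDiff_w
  have ha := h.smooth_a
  have hc := pd_comm (h.smooth_a s p) q s x
  simp only [sol_in_lead_y h hp hq hps hqs hpq, sol_in_pd_lead_lead_y h hp hps] at hc
  rw [pd_add _ (by fun_prop) (by fun_prop), pd_mul _ _ (by fun_prop),
    pd_fmul _ (hl p) (hw s), pd_w, hs, sol_in_lead_y h hp hq hps hqs hpq,
    sol_in_pd_lead h hq hp hqs hps, if_neg (by simpa using hqs.symm)] at hc
  refine mul_left_cancel₀ (w_ne (B := B) x s) ?_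
  linarith

theorem sol_pd_self_lam (hp : B.lead p = some s) (hps : p ≠ s) (x : Fin n → ℝ) :
    pd p (fun y => lam y p) x = B.ε p * (pd s (fun y => lam y s) x - 2 * lam x s) := by
  have hs := B.lead_lead hp
  have hl := h.smooth_lam
  have hw := B.contDiff_w
  have ha := h.smooth_a
  have hc := pd_comm (h.smooth_a s p) p s x
  simp only [sol_in_lead_self h hp hps, sol_in_pd_lead_lead_y h hp hps] at hc
  rw [pd_add _ (by fun_prop) (by fun_prop), pd_mul _ _ (by fun_prop),
    pd_fmul _ (hl p) (hw s), pd_w, hs, sol_in_lead_self h hp hps,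
    pd_add _ (by fun_prop) (by fun_prop), pd_sub _ (by fun_prop) (by fun_prop),
    pd_mul _ _ (by fun_prop), pd_fmul _ (hl s) (hw p), pd_w, hp, sol_in_pd_lead h hp hp hps hps,
    sol_in_pd_lead_lead h hs, if_neg (by simpa using hps.symm), if_pos rfl,
    w_some hp, ← w_lead hs] at hc
  refine mul_left_cancel₀ (w_ne (B := B) x s) ?_
  linarith

theorem sol_pd_lead_lam_y (hp : B.lead p = some s) (hps : p ≠ s) (x : Fin n → ℝ) :
    pd s (fun y => lam y p) x = lam x p := by
  have hs := B.lead_lead hp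
  have hl := h.smooth_lam
  have hw := B.contDiff_w
  have ha := h.smooth_a
  obtain ⟨q, hqp, hqs, hq⟩ := exists_other hs p
  have hc := pd_comm (h.smooth_a q p) s q x
  simp only [sol_in_offdiag h hq hp hqs hps hqp, sol_in_pd_lead h hq hp hqs hps] at hc
  rw [pd_add _ (by fun_prop) (by fun_prop), pd_mul _ _ (by fun_prop),
    pd_mul _ _ (by fun_prop), pd_fmul _ (hl p) (hw q), pd_w, if_pos hq,
    sol_in_pd_lead_lead_y h hp hps, sol_in_offdiag h hq hp hqs hps hqp,
    w_some hq, ← w_lead hs] at hc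
  refine mul_left_cancel₀ (mul_ne_zero (B.ε_ne q) (w_ne (B := B) x s)) ?_
  linarith

/-- In the integrability condition of `a p q` along `p` and `q`, the terms in λ and in `a s s`
cancel, leaving ε_p a_{qq} = ε_q a_{pp}. -/
theorem sol_diag_eq (hp : B.lead p = some s) (hq : B.lead q = some s) (hps : p ≠ s)
    (hqs : q ≠ s) (hpq : p ≠ q) (x : Fin n → ℝ) : a x p p = B.ε p * B.ε q * a x q q := by
  have hs := B.lead_lead hp
  have hl := h.smooth_lam
  have hw := B.contDiff_w
  have ha := h.smooth_a
  have e : (fun y => a y p q) = fun y => a y q p := funext fun y => sol_symm h y p q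
  have hc := pd_comm (h.smooth_a p q) q p x
  simp only [sol_in_offdiag h hp hq hps hqs hpq] at hc
  simp only [e, sol_in_offdiag h hq hp hqs hps hpq.symm] at hc
  rw [pd_add _ (by fun_prop) (by fun_prop), pd_mul _ _ (by fun_prop), pd_fmul _ (hl q) (hw p),
    pd_add _ (by fun_prop) (by fun_prop), pd_mul _ _ (by fun_prop), pd_fmul _ (hl p) (hw q),
    pd_w, pd_w, hp, hq, if_neg (by simpa using hqs.symm), if_neg (by simpa using hps.symm),
    sol_in_lead_self h hp hps, sol_in_lead_self h hq hqs, sol_pd_self_lam h hp hps,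
    sol_pd_self_lam h hq hqs, w_some hp, w_some hq] at hc
  have h1 : B.ε p * a x q q = B.ε q * a x p p := by linarith
  have h2 := B.ε_mul_self q
  linear_combination - B.ε q * h1 - a x p p * h2

/-- Apply integrability to λ_q itself: ∂_q λ_q = ε_q(∂_s λ_s − 2λ_s) has zero derivative along `p`,
but that derivative equals ε_q(λ_p − 2λ_p). -/
theorem sol_lam_y_eq_zero (hp : B.lead p = some s) (hps : p ≠ s) (x : Fin n → ℝ) :
    lam x p = 0 := by
  have hs := B.lead_lead hp
  have hl := h.smooth_lam
  have hls := contDiff_pd (hl s) s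
  obtain ⟨q, hqp, hqs, hq⟩ := exists_other hs p
  have hc := pd_comm (hl q) p q x
  simp only [sol_pd_self_lam h hq hqs, sol_pd_ne_lam h hq hp hqs hps hqp, pd_const] at hc
  rw [pd_mul _ _ (by fun_prop), pd_sub _ (by fun_prop) (by fun_prop), pd_mul _ _ (by fun_prop),
    pd_comm (hl s) p s] at hc
  simp only [sol_pd_y_lam_lead h hp hps, sol_pd_lead_lam_y h hp hps] at hc
  have := (mul_eq_zero.mp hc).resolve_left (B.ε_ne q)
  linarith

/-- The diagonal entry `a p p` is a constant multiple of `a q q`, which does not depend on `p`. Its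
derivative along `p` is −2ε_p a_{sp} once λ_p = 0. -/
theorem sol_lead_y_eq_zero (hp : B.lead p = some s) (hps : p ≠ s) (x : Fin n → ℝ) :
    a x s p = 0 := by
  have hs := B.lead_lead hp
  obtain ⟨q, hqp, hqs, hq⟩ := exists_other hs p
  have h1 := sol_in_self h hp hps x
  simp only [sol_diag_eq h hp hq hps hqs hqp.symm] at h1
  rw [pd_mul _ _ (h.smooth_a q q), sol_in_diag h hq hp hqs hps hqp,
    sol_lam_y_eq_zero h hp hps] at h1
  have : B.ε p * a x s p = 0 := by linarith
  exact (mul_eq_zero.mp this).resolve_left (B.ε_ne p)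

theorem sol_y_ne_eq_zero (hp : B.lead p = some s) (hq : B.lead q = some s) (hps : p ≠ s)
    (hqs : q ≠ s) (hpq : p ≠ q) (x : Fin n → ℝ) : a x p q = 0 := by
  have h1 := sol_in_lead_y h hq hp hqs hps hpq.symm x
  simp only [sol_lead_y_eq_zero h hq hqs, pd_const] at h1
  exact h1.symm

theorem sol_diag (hp : B.lead p = some s) (hps : p ≠ s) (x : Fin n → ℝ) :
    a x p p = B.ε p * (a x s s - B.w x s * lam x s) := by
  have hs := B.lead_lead hp
  have h1 := sol_in_lead_self h hp hps x
  simp only [sol_lead_y_eq_zero h hp hps, pd_const] at h1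
  rw [w_some hp, ← w_lead hs] at h1
  linarith

theorem sol_pd_lam_lead (hs : B.lead s = some s) (k : Fin n) (x : Fin n → ℝ) :
    pd k (fun y => lam y s) x = if k = s then 2 * lam x s else 0 := by
  obtain ⟨p, -, -, hps, -, hp, -⟩ := B.exists_ne hs
  by_cases hk : B.lead k = some s
  · by_cases hks : k = s
    · subst hks
      have h1 := sol_pd_self_lam h hp hps x
      simp only [sol_lam_y_eq_zero h hp hps, pd_const] at h1
      have := (mul_eq_zero.mp h1.symm).resolve_left (B.ε_ne p)
      rw [if_pos rfl]
      linarith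
    · rw [if_neg hks, sol_pd_y_lam_lead h hk hks, sol_lam_y_eq_zero h hk hks]
  · have hks : s ≠ k := fun e => hk (e ▸ hs)
    have h1 := sol_in_off h hp hp hk x
    have hl := h.smooth_lam
    have hw := B.contDiff_w
    have ha := h.smooth_a
    simp only [sol_diag h hp hps] at h1
    rw [pd_mul _ _ (by fun_prop), pd_sub _ (by fun_prop) (by fun_prop), pd_fmul _ (hw s) (hl s),
      pd_w, hs, sol_in_off h hs hs hk, if_neg (by simpa using hks)] at h1
    have h2 := (mul_eq_zero.mp h1).resolve_left (B.ε_ne p)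
    rw [if_neg hks.symm]
    have h3 : B.w x s * pd k (fun y => lam y s) x = 0 := by linarith
    exact (mul_eq_zero.mp h3).resolve_left (w_ne x s)

theorem sol_lam_lead (hs : B.lead s = some s) (x : Fin n → ℝ) :
    lam x s = lam 0 s * B.w x s := by
  rw [w_lead hs]
  exact exists_eq_const_mul_exp (h.smooth_lam s) (sol_pd_lam_lead h hs) x

theorem sol_lead_lead (hs : B.lead s = some s) (x : Fin n → ℝ) :
    a x s s = (a 0 s s - lam 0 s) * B.w x s + lam 0 s * (B.w x s * B.w x s) := by
  obtain ⟨p, q, hpq, hps, hqs, hp, hq⟩ := B.exists_ne hs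
  -- The entry `a p p` is a constant multiple of e^{2s}; `sol_diag` then recovers `a s s` from it
  -- and λ_s.
  have h1 : ∀ k x, pd k (fun y => a y p p) x = if k = s then 2 * a x p p else 0 := by
    intro k x
    by_cases hk : B.lead k = some s
    · by_cases hks : k = s
      · subst hks; rw [if_pos rfl, sol_in_pd_lead h hp hp hps hps]
      · rw [if_neg hks]
        by_cases hkp : p = k
        · subst hkp
          rw [sol_in_self h hp hps, sol_lead_y_eq_zero h hp hps, sol_lam_y_eq_zero h hp hps]
          ring
        · exact sol_in_diag h hp hk hps hks hkp x
    · rw [if_neg fun e => hk (by rw [e, hs]), sol_in_off h hp hp hk]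
  have h2 := exists_eq_const_mul_exp (h.smooth_a p p) h1 x
  have h0 : B.w 0 s = 1 := by simp [w_lead hs]
  rw [← w_lead hs, sol_diag h hp hps, sol_diag h hp hps, h0, mul_assoc] at h2
  have h3 := mul_left_cancel₀ (B.ε_ne p) h2
  rw [sol_lam_lead h hs x] at h3
  linarith

end InBlock

/-- The mixed entry of two blocks is both w_s λ_t and w_t λ_s. This ties all cones to one common
multiple of θ. -/
theorem sol_lam_lead_eq {s t : Fin n} (hs : B.lead s = some s) (ht : B.lead t = some t) :
    lam 0 s = lam 0 t := by
  by_cases hst : s = t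
  · rw [hst]
  · have h1 := sol_off_lead_eq h (s := s) (j := t) (by rw [ht]; simpa using Ne.symm hst) hs 0
    have h2 := sol_off_lead_eq h (s := t) (j := s) (by rw [hs]; simpa using hst) ht 0
    rw [sol_symm h, h2] at h1
    simpa [w_lead hs, w_lead ht] using h1

theorem sol_lam_flat {s : Fin n} (hs : B.lead s = some s) {j : Fin n} (hj : B.lead j = none)
    (x : Fin n → ℝ) : lam x j = lam 0 s * x j + lam 0 j := by
  have hl := h.smooth_lam
  have hw := B.contDiff_w
  -- Along a flat direction, differentiate a_{sj} = w_s λ_j for the cone led by `s`. The equation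
  -- gives w_s ∂_k λ_j = λ_s g_{jk}, where λ_s is a constant multiple of w_s.
  have hk : ∀ k x, pd k (fun y => lam y j) x = if j = k then lam 0 s else 0 := by
    intro k x
    rcases B.cases_index k with hk | hk | ⟨t, hk, hkt⟩
    · have hjs : B.lead j ≠ some s := by simp [hj]
      have hsk : s ≠ k := fun e => by rw [← e, hs] at hk; cases hk
      have h1 := sol_pd h s j k x
      simp only [sol_off_lead_eq h hjs hs] at h1
      rw [pd_fmul k (hw s) (hl j), pd_w, hs, if_neg (by simpa using hsk),
        conn_flat _ hj, conn_symm, conn_flat _ hk, sol_lam_lead h hs, metric_apply, metric_apply,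
        w_flat hj, if_neg hsk] at h1
      refine mul_left_cancel₀ (w_ne (B := B) x s) ?_
      by_cases e : j = k
      · subst e
        simp only [if_true, mul_one, mul_zero, add_zero, zero_add] at h1 ⊢
        rw [h1, mul_comm]
      · simp [e] at h1 ⊢; exact h1
    · rw [if_neg fun e => by rw [← e, hj] at hk; cases hk]
      exact sol_off_pd_lead_lam h (by simp [hj]) hk x
    · rw [if_neg fun e => by rw [← e, hj] at hk; cases hk]
      exact sol_off_pd_y_lam h (by simp [hj]) hk hkt x
  have h1 := eq_of_pd_eq_zero (f := fun x => lam x j - lam 0 s * x j) (by fun_prop)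
    (fun k x => by
      rw [pd_sub k (hl j) (by fun_prop), hk, pd_mul k _ (by fun_prop), pd_coord]
      split_ifs <;> ring) x 0
  simp at h1
  linarith

theorem sol_flat_flat {s : Fin n} (hs : B.lead s = some s) {i j : Fin n} (hi : B.lead i = none)
    (hj : B.lead j = none) (x : Fin n → ℝ) :
    a x i j = lam 0 s * (x i * x j) + lam 0 i * x j + lam 0 j * x i + a 0 i j := by
  have h1 := eq_of_pd_eq_zero
    (f := fun x => a x i j - (lam 0 s * (x i * x j) + lam 0 i * x j + lam 0 j * x i))
    ((h.smooth_a i j).sub (by fun_prop))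
    (fun k x => by
      rw [pd_sub k (h.smooth_a i j) (by fun_prop), pd_add k (by fun_prop) (by fun_prop),
        pd_add k (by fun_prop) (by fun_prop), pd_mul k _ (by fun_prop), pd_mul k _ (by fun_prop),
        pd_mul k _ (by fun_prop), pd_fmul k (by fun_prop) (by fun_prop), pd_coord, pd_coord,
        sol_pd h, conn_flat _ hi, conn_flat _ hj, sol_lam_flat h hs hi, sol_lam_flat h hs hj,
        metric_apply, metric_apply, w_flat hi, w_flat hj]
      split_ifs <;> ring) x 0
  simp at h1
  linarith

end Classification

theorem solMap_surjective {s₀ : Fin n} (hs₀ : B.lead s₀ = some s₀) :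
    Function.Surjective B.solMap := by
  rintro ⟨⟨a, lam⟩, h⟩
  replace h : IsSinjukovSolution B.metric a lam := h
  -- The index `none` stands for θ, so `K` collects the symmetric form on θ and the flat
  -- differentials from values at the origin.
  let K : Option {i // B.lead i = none} → Option {i // B.lead i = none} → ℝ := fun u v =>
    match u, v with
    | none, none => lam 0 s₀
    | none, some j => lam 0 j
    | some i, none => lam 0 i
    | some i, some j => a 0 i j
  have hK : ∀ u v, K u v = K v u := by
    rintro (_ | i) (_ | j)
    · rfl
    · rfl
    · rfl
    · exact sol_symm h 0 i j
  -- At the origin w_s = 1, so a_{ss} is the block scalar plus the contribution λ_s of θ⊗θ, which is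
  -- subtracted.
  let v : B.Param := Sum.elim (Sym2.lift ⟨K, hK⟩) fun s => a 0 s s - lam 0 s
  have hθ : coeffθ v = lam 0 s₀ := rfl
  have hmix : ∀ i, B.lead i = none → coeffMixed v i = lam 0 i := by
    intro i hi
    rw [coeffMixed, dif_pos hi]
    rfl
  have hmix' : ∀ i s, B.lead i = some s → coeffMixed v i = 0 :=
    fun i s hi => coeffMixed_of_ne (by simp [hi])
  have hflat : ∀ i j, B.lead i = none → B.lead j = none → coeffFlat v i j = a 0 i j := by
    intro i j hi hj
    rw [coeffFlat, dif_pos ⟨hi, hj⟩]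
    rfl
  have hblock : ∀ i s, B.lead i = some s → coeffBlock v i = a 0 s s - lam 0 s :=
    fun i s hi => coeffBlock_some v hi
  have hform : solForm v = lam := by
    funext x i
    rw [solForm, hθ]
    rcases B.cases_index i with hi | hi | ⟨s, hi, his⟩
    · rw [hmix i hi, θ_flat hi, sol_lam_flat h hs₀ hi x]
    · rw [hmix' i i hi, θ_lead hi, sol_lam_lead h hi x, sol_lam_lead_eq h hs₀ hi, add_zero]
    · rw [hmix' i s hi, θ_of_ne hi his, sol_lam_y_eq_zero h hi his]
      ring
  -- Rows indexed by block coordinates come first; the entries with a flat row and a block column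
  -- then follow by symmetry.
  have hcol : ∀ x i s, B.lead i = some s → ∀ j, solTensor v x i j = a x i j := by
    intro x i s hi j
    have hs := B.lead_lead hi
    rw [solTensor_apply, coeffFlat_of_ne (by simp [hi]), hmix' i s hi, hblock i s hi]
    by_cases hj : B.lead j = some s
    · rw [hmix' j s hj, hθ, sol_lam_lead_eq h hs₀ hs, metric_apply]
      by_cases his : i = s
      · subst his
        by_cases hji : j = i
        · subst hji
          rw [θ_lead hs, if_pos rfl, sol_lead_lead h hs x]
          ring
        · rw [if_neg (Ne.symm hji), θ_of_ne hj hji, sol_lead_y_eq_zero h hj hji]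
          ring
      · rw [θ_of_ne hi his]
        by_cases hij : i = j
        · subst hij
          rw [if_pos rfl, sol_diag h hi his x, sol_lead_lead h hs x, sol_lam_lead h hs x,
            w_some hi, ← w_lead hs]
          ring
        · rw [if_neg hij]
          by_cases hjs : j = s
          · subst hjs
            rw [sol_symm h x, sol_lead_y_eq_zero h hi his]
            ring
          · rw [sol_y_ne_eq_zero h hi hj his hjs hij]
            ring
    · have hij : i ≠ j := fun e => hj (e ▸ hi)
      rw [metric_apply, if_neg hij]
      by_cases his : i = s
      · subst his
        rw [sol_off_lead_eq h hj hs, θ_lead hs, ← congrFun (congrFun hform x) j, solForm]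
        ring
      · rw [θ_of_ne hi his, sol_off_y_eq_zero h hj hi his]
        ring
  have hten : solTensor v = a := by
    funext x
    ext i j
    rcases hi : B.lead i with _ | s
    · rcases hj : B.lead j with _ | t
      · rw [solTensor_apply, hθ, hmix i hi, hmix j hj, hflat i j hi hj, coeffBlock_flat v hi,
          θ_flat hi, θ_flat hj, sol_flat_flat h hs₀ hi hj x]
        ring
      · rw [← (solTensor_symm v x).apply, hcol x j t hj, sol_symm h]
    · exact hcol x i s hi j
  exact ⟨v, Subtype.ext (Prod.ext hten hform)⟩

theorem degreeOfMobility_metric {s₀ : Fin n} (hs₀ : B.lead s₀ = some s₀) :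
    degreeOfMobility B.metric
      = Nat.choose (Fintype.card {i // B.lead i = none} + 2) 2
        + Fintype.card {s // B.lead s = some s} := by
  have e := LinearEquiv.ofBijective B.solMap ⟨solMap_injective hs₀, solMap_surjective hs₀⟩
  rw [degreeOfMobility, ← e.finrank_eq, Module.finrank_fintype_fun_eq_card, Fintype.card_sum,
    Sym2.card, Fintype.card_option]

end ConeBlocks
end GeodEquiv
end
-- The choice of blocks and the count of parameters.
noncomputable section
namespace GeodEquiv
namespace ConeBlocks

/-- The splitting of `n` coordinates into `f` flat ones, followed by `l` blocks of which all but the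
last have size three; the last coordinate is timelike. -/
def standard (n f l : ℕ) (hl : 1 ≤ l) (h : f + 3 * l ≤ n) : ConeBlocks n where
  -- Capping the block number at `l - 1` lets the last block absorb all leftover coordinates.
  lead i := if i.1 < f then none else some ⟨f + 3 * min ((i.1 - f) / 3) (l - 1), by omega⟩
  -- As `1 ≤ l` and every block has at least three members, the last coordinate is neither flat nor
  -- leading.
  ε i := if i.1 = n - 1 then -1 else 1
  lead_lead {i s} hi := by
    split_ifs at hi with hif
    simp only [Option.some.injEq] at hi
    subst hi
    rw [if_neg (by simp)]
    simp only [Option.some.injEq, Fin.mk.injEq]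
    omega
  ε_mul_self i := by split_ifs <;> norm_num
  ε_flat {i} hi := by
    split_ifs at hi with hif
    rw [if_neg (by omega)]
  ε_lead {s} hs := by
    split_ifs at hs with hif
    simp only [Option.some.injEq, Fin.ext_iff] at hs
    rw [if_neg (by omega)]
  exists_ne {s} hs := by
    split_ifs at hs with hif
    simp only [Option.some.injEq, Fin.ext_iff] at hs
    refine ⟨⟨s.1 + 1, by omega⟩, ⟨s.1 + 2, by omega⟩, ?_, ?_, ?_, ?_, ?_⟩
    · simp [Fin.ext_iff]
    · simp [Fin.ext_iff]
    · simp [Fin.ext_iff]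
    · rw [if_neg (by simp only; omega)]
      simp only [Option.some.injEq, Fin.ext_iff]
      omega
    · rw [if_neg (by simp only; omega)]
      simp only [Option.some.injEq, Fin.ext_iff]
      omega

variable {n f l : ℕ} (hl : 1 ≤ l) (h : f + 3 * l ≤ n)

theorem standard_lead_eq_none {i : Fin n} : (standard n f l hl h).lead i = none ↔ i.1 < f := by
  simp [standard]

theorem standard_lead_eq_self {i : Fin n} :
    (standard n f l hl h).lead i = some i ↔ ∃ m < l, i.1 = f + 3 * m := by
  simp only [standard]
  constructor
  · intro hi
    split_ifs at hi with hif
    simp only [Option.some.injEq, Fin.ext_iff] at hi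
    exact ⟨min ((i.1 - f) / 3) (l - 1), by omega, hi.symm⟩
  · rintro ⟨m, hm, hi⟩
    rw [if_neg (by omega)]
    simp only [Option.some.injEq, Fin.ext_iff]
    omega

theorem card_standard_flat :
    Fintype.card {i // (standard n f l hl h).lead i = none} = f := by
  conv_rhs => rw [← Fintype.card_fin f]
  exact (Fintype.card_of_bijective (f := fun j : Fin f =>
    (⟨⟨j.1, by omega⟩, (standard_lead_eq_none hl h).mpr j.2⟩ :
      {i // (standard n f l hl h).lead i = none}))
    ⟨fun a b hab => by simpa [Fin.ext_iff] using hab,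
      fun ⟨i, hi⟩ => ⟨⟨i.1, (standard_lead_eq_none hl h).mp hi⟩, rfl⟩⟩).symm

theorem card_standard_lead :
    Fintype.card {s // (standard n f l hl h).lead s = some s} = l := by
  conv_rhs => rw [← Fintype.card_fin l]
  exact (Fintype.card_of_bijective (f := fun j : Fin l =>
    (⟨⟨f + 3 * j.1, by omega⟩, (standard_lead_eq_self hl h).mpr ⟨j.1, j.2, rfl⟩⟩ :
      {s // (standard n f l hl h).lead s = some s}))
    ⟨fun a b hab => by simpa [Fin.ext_iff] using hab,
      fun ⟨i, hi⟩ => by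
        obtain ⟨m, hm, him⟩ := (standard_lead_eq_self hl h).mp hi
        exact ⟨⟨m, hm⟩, by simp [Fin.ext_iff, him]⟩⟩).symm

/-- The product of a flat space of dimension `f` with `l` cones has degree of mobility
`(f + 1) (f + 2) / 2 + l`. -/
theorem exists_metric (hl : 1 ≤ l) (h : f + 3 * l ≤ n) :
    ∃ g : TensorField n, IsLorentzian g ∧
      (∃ gbar : TensorField n, IsPseudoRiemannian gbar ∧
        GeodesicallyEquivalent g gbar ∧ ¬ AffinelyEquivalent g gbar) ∧
      degreeOfMobility g = (f + 1) * (f + 2) / 2 + l := by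
  have hs : (standard n f l hl h).lead ⟨f, by omega⟩ = some ⟨f, by omega⟩ :=
    (standard_lead_eq_self hl h).mpr ⟨0, by omega, rfl⟩
  refine ⟨(standard n f l hl h).metric,
    isLorentzian_metric (z := ⟨n - 1, by omega⟩) (if_pos rfl) fun i hi => if_neg fun e => hi ?_,
    ⟨_, isPseudoRiemannian_projMetric, geodesicallyEquivalent, not_affinelyEquivalent hs⟩, ?_⟩
  · exact Fin.ext e
  · rw [degreeOfMobility_metric hs, card_standard_flat, card_standard_lead, Nat.choose_two_right]
    congr 2
    rw [mul_comm]
    rfl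

end ConeBlocks
end GeodEquiv
end

theorem theorem2 (n k l : ℕ) (hn : 3 ≤ n) (hk : k ≤ n - 2)
    (hl : 1 ≤ l) (hl' : l ≤ (n - k + 1) / 3) (hD : 2 ≤ k * (k + 1) / 2 + l) :
    ∃ g : GeodEquiv.TensorField n, GeodEquiv.IsLorentzian g ∧
      (∃ gbar : GeodEquiv.TensorField n, GeodEquiv.IsPseudoRiemannian gbar ∧
        GeodEquiv.GeodesicallyEquivalent g gbar ∧ ¬ GeodEquiv.AffinelyEquivalent g gbar) ∧
      GeodEquiv.degreeOfMobility g = k * (k + 1) / 2 + l := by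
  rcases k with _ | f
  -- For k = 0 use f = 0 and `l - 1` cones: the solution θ⊗θ makes up the difference, and `hD`
  -- ensures that at least one cone remains.
  · obtain ⟨l, rfl⟩ : ∃ m, l = m + 1 := ⟨l - 1, by omega⟩
    have := GeodEquiv.ConeBlocks.exists_metric (n := n) (f := 0) (l := l) (by omega) (by omega)
    simpa [add_comm] using this
  -- With k = f + 1, the bound on `l` is exactly f + 3l ≤ n.
  · exact GeodEquiv.ConeBlocks.exists_metric hl (by omega)
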